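/- Let $k$ be a field and let $R=\begin{pmatrix} k & k^2\\ 0 & k\end{pmatrix}$ be the Kronecker algebra, where $k^2$ is a $k$-$k$-bimodule by $a(b,c)d=(abd,acd)$. A representation $\alpha,\beta\colon M_2\rightrightarrows M_1$ of the Kronecker quiver over $k$ is regarded as the left $R$-module of column vectors $(m_1,m_2)^{T}$, with action $$\begin{pmatrix} a & (c,d)\\ 0 & b\end{pmatrix}\begin{pmatrix} m_1\\ m_2\end{pmatrix}=\begin{pmatrix} a m_1+c\,\alpha(m_2)+d\,\beta(m_2)\\ b\, m_2\end{pmatrix}.$$ Let $V$ be the module given by $0,1\colon k\rightrightarrows k$ and, for a monic irreducible polynomial $p\in k[x]$, let $V_{p}$ be the module given by $1,x\colon k[x]/(p)\rightrightarrows k[x]/(p)$. Let $\Delta$ be any set of monic irreducible polynomials in $k[x]$, and let $\mathcal U=\{V\}\cup\{V_{p}\mid p\in\Delta\}$. A universal localization of $R$ at $\mathcal U$ is a ring homomorphism $\lambda\colon R\to R_{\mathcal U}$ for which there are exact sequences $0\to P_U\xrightarrow{f_U}Q_U\to U\to 0$ with $P_U,Q_U$ finitely generated projective, one for each $U\in\mathcal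 U$, such that $R_{\mathcal U}\otimes_R f_U$ is an isomorphism for all $U\in\mathcal U$ and every ring homomorphism $R\to T$ for which all $T\otimes_R f_U$ are isomorphisms factors uniquely through $\lambda$. Let $D$ be the smallest subring of $k(x)$ that contains $k[x]$ and $\frac1{p}$ for all $p\in\Delta$. Then $D$ is a Dedekind domain (fields allowed), a universal localization of $R$ at $\mathcal U$ exists and is realized by a ring homomorphism $R\to M_2(D)$, and for every universal localization $R\to R_{\mathcal U}$ of $R$ at $\mathcal U$ there is a ring isomorphism $R_{\mathcal U}\cong M_2(D)$. In particular, $R_{\mathcal U}$ is Morita equivalent to $D$. -/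

import Mathlib

open Polynomial
open scoped TensorProduct

universe u

/-! ### Extension of scalars along a homomorphism of (noncommutative) rings -/

section ExtendScalars

variable {R S : Type u} [Ring R] [Ring S] (φ : R →+* S)

/-- The relations `(s φ(r)) ⊗ p = s ⊗ (r p)` that cut `S ⊗_R P` out of `S ⊗_ℤ P`. -/
def balancedRelations (P : Type u) [AddCommGroup P] [Module R P] : Submodule S (S ⊗[ℤ] P) :=
  Submodule.span S
    {z | ∃ (s : S) (r : R) (p : P), z = (s * φ r) ⊗ₜ[ℤ] p - s ⊗ₜ[ℤ] (r • p)}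

/-- The left `S`-module `S ⊗_R P`, where `S` is a right `R`-module through `φ : R → S`. -/
abbrev ExtendedModule (P : Type u) [AddCommGroup P] [Module R P] : Type u :=
  (S ⊗[ℤ] P) ⧸ balancedRelations φ P

/-- `id ⊗ f : S ⊗_ℤ P → S ⊗_ℤ Q` as an `S`-linear map. -/
noncomputable def intTensorMap {P Q : Type u} [AddCommGroup P] [Module R P]
    [AddCommGroup Q] [Module R Q] (f : P →ₗ[R] Q) : S ⊗[ℤ] P →ₗ[S] S ⊗[ℤ] Q :=
  TensorProduct.AlgebraTensorModule.map (LinearMap.id : S →ₗ[S] S) f.toAddMonoidHom.toIntLinearMap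

theorem balancedRelations_le_comap {P Q : Type u} [AddCommGroup P] [Module R P]
    [AddCommGroup Q] [Module R Q] (f : P →ₗ[R] Q) :
    balancedRelations φ P ≤ (balancedRelations φ Q).comap (intTensorMap (S := S) f) := by
  refine Submodule.span_le.2 ?_
  rintro _ ⟨s, r, p, rfl⟩
  refine Submodule.subset_span ⟨s, r, f p, ?_⟩
  simp [intTensorMap]

/-- The `S`-linear map `S ⊗_R f : S ⊗_R P → S ⊗_R Q`. -/
noncomputable def extendedMap {P Q : Type u} [AddCommGroup P] [Module R P]
    [AddCommGroup Q] [Module R Q] (f : P →ₗ[R] Q) :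
    ExtendedModule φ P →ₗ[S] ExtendedModule φ Q :=
  Submodule.mapQ _ _ (intTensorMap f) (balancedRelations_le_comap φ f)

end ExtendScalars

/-! ### Universal localization -/

/-- A homomorphism between finitely generated projective left `R`-modules. -/
structure FGProjMap (R : Type u) [Ring R] where
  P : Type u
  Q : Type u
  [addCommGroupP : AddCommGroup P]
  [addCommGroupQ : AddCommGroup Q]
  [moduleP : Module R P]
  [moduleQ : Module R Q]
  [finiteP : Module.Finite R P]
  [finiteQ : Module.Finite R Q]
  [projectiveP : Module.Projective R P]
  [projectiveQ : Module.Projective R Q]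
  map : P →ₗ[R] Q

attribute [instance] FGProjMap.addCommGroupP FGProjMap.addCommGroupQ
  FGProjMap.moduleP FGProjMap.moduleQ FGProjMap.finiteP FGProjMap.finiteQ
  FGProjMap.projectiveP FGProjMap.projectiveQ

/-- `φ : R → S` is `Σ`-inverting: `S ⊗_R α` is an isomorphism for every `α ∈ Σ`. -/
def IsInverting {R S : Type u} [Ring R] [Ring S] (Sig : Set (FGProjMap R)) (φ : R →+* S) : Prop :=
  ∀ α ∈ Sig, Function.Bijective (extendedMap φ α.map)

/-- `φ : R → S` is the universal localization of `R` at `Σ`: it is `Σ`-inverting, and every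
`Σ`-inverting homomorphism factors uniquely through it. -/
structure IsUniversalLocalization {R S : Type u} [Ring R] [Ring S]
    (Sig : Set (FGProjMap R)) (φ : R →+* S) : Prop where
  inverting : IsInverting Sig φ
  universal : ∀ (T : Type u) [Ring T] (θ : R →+* T), IsInverting Sig θ →
    ∃! ψ : S →+* T, ψ.comp φ = θ

/-- An exact sequence `0 → P → Q → U → 0` with `P`, `Q` finitely generated projective. -/
structure FGProjPresentation (R : Type u) [Ring R] (U : Type u) [AddCommGroup U] [Module R U]
    extends FGProjMap R where
  proj : Q →ₗ[R] U
  injective : Function.Injective map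
  exact : Function.Exact map proj
  surjective : Function.Surjective proj

/-- `φ : R → S` is a universal localization of `R` at the set `𝒰` of modules: it is the universal
localization at `{f_U | U ∈ 𝒰}` for some choice of finitely generated projective presentations
`f_U`, one for each `U ∈ 𝒰`. -/
def IsUniversalLocalizationAt {R S : Type u} [Ring R] [Ring S]
    (𝒰 : Set (ModuleCat.{u} R)) (φ : R →+* S) : Prop :=
  ∃ f : ∀ U : 𝒰, FGProjPresentation R U.1,
    IsUniversalLocalization (Set.range fun U => (f U).toFGProjMap) φ

/-! ### The Kronecker algebra -/

/-- The triangular matrix ring with entries `a`, `v`, `0`, `b`, where `a, b ∈ k` and `v ∈ k²`. -/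
@[ext]
structure KroneckerAlgebra (k : Type u) where
  a : k
  v : k × k
  b : k

namespace KroneckerAlgebra

variable {k : Type u} [Field k]

instance : Zero (KroneckerAlgebra k) := ⟨⟨0, 0, 0⟩⟩
instance : One (KroneckerAlgebra k) := ⟨⟨1, 0, 1⟩⟩
instance : Add (KroneckerAlgebra k) := ⟨fun r s => ⟨r.a + s.a, r.v + s.v, r.b + s.b⟩⟩
instance : Neg (KroneckerAlgebra k) := ⟨fun r => ⟨-r.a, -r.v, -r.b⟩⟩
instance : Mul (KroneckerAlgebra k) :=
  ⟨fun r s => ⟨r.a * s.a, r.a • s.v + s.b • r.v, r.b * s.b⟩⟩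

@[simp] theorem zero_a : (0 : KroneckerAlgebra k).a = 0 := rfl
@[simp] theorem zero_v : (0 : KroneckerAlgebra k).v = 0 := rfl
@[simp] theorem zero_b : (0 : KroneckerAlgebra k).b = 0 := rfl
@[simp] theorem one_a : (1 : KroneckerAlgebra k).a = 1 := rfl
@[simp] theorem one_v : (1 : KroneckerAlgebra k).v = 0 := rfl
@[simp] theorem one_b : (1 : KroneckerAlgebra k).b = 1 := rfl
@[simp] theorem add_a (r s : KroneckerAlgebra k) : (r + s).a = r.a + s.a := rfl
@[simp] theorem add_v (r s : KroneckerAlgebra k) : (r + s).v = r.v + s.v := rfl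
@[simp] theorem add_b (r s : KroneckerAlgebra k) : (r + s).b = r.b + s.b := rfl
@[simp] theorem neg_a (r : KroneckerAlgebra k) : (-r).a = -r.a := rfl
@[simp] theorem neg_v (r : KroneckerAlgebra k) : (-r).v = -r.v := rfl
@[simp] theorem neg_b (r : KroneckerAlgebra k) : (-r).b = -r.b := rfl
@[simp] theorem mul_a (r s : KroneckerAlgebra k) : (r * s).a = r.a * s.a := rfl
@[simp] theorem mul_v (r s : KroneckerAlgebra k) : (r * s).v = r.a • s.v + s.b • r.v := rfl
@[simp] theorem mul_b (r s : KroneckerAlgebra k) : (r * s).b = r.b * s.b := rfl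

instance : Ring (KroneckerAlgebra k) where
  add_assoc _ _ _ := by ext <;> simp [add_assoc]
  zero_add _ := by ext <;> simp
  add_zero _ := by ext <;> simp
  add_comm _ _ := by ext <;> simp [add_comm]
  neg_add_cancel _ := by ext <;> simp
  nsmul := nsmulRec
  zsmul := zsmulRec
  mul_assoc _ _ _ := by ext <;> simp <;> ring
  one_mul _ := by ext <;> simp
  mul_one _ := by ext <;> simp
  zero_mul _ := by ext <;> simp
  mul_zero _ := by ext <;> simp
  left_distrib _ _ _ := by ext <;> simp <;> ring
  right_distrib _ _ _ := by ext <;> simp <;> ring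

/-- The left module over the Kronecker algebra that corresponds to the representation
`α, β : M₂ ⇉ M₁` of the Kronecker quiver: the column vectors `(m₁, m₂)`. -/
@[ext]
structure RepModule {M₁ M₂ : Type u} [AddCommGroup M₁] [AddCommGroup M₂] [Module k M₁] [Module k M₂]
    (α β : M₂ →ₗ[k] M₁) : Type u where
  fst : M₁
  snd : M₂

namespace RepModule

variable {M₁ M₂ : Type u} [AddCommGroup M₁] [AddCommGroup M₂] [Module k M₁] [Module k M₂]
  {α β : M₂ →ₗ[k] M₁}

instance : Zero (RepModule α β) := ⟨⟨0, 0⟩⟩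
instance : Add (RepModule α β) := ⟨fun m n => ⟨m.fst + n.fst, m.snd + n.snd⟩⟩
instance : Neg (RepModule α β) := ⟨fun m => ⟨-m.fst, -m.snd⟩⟩
instance : SMul (KroneckerAlgebra k) (RepModule α β) :=
  ⟨fun r m => ⟨r.a • m.fst + (r.v.1 • α m.snd + r.v.2 • β m.snd), r.b • m.snd⟩⟩

@[simp] theorem zero_fst : (0 : RepModule α β).fst = 0 := rfl
@[simp] theorem zero_snd : (0 : RepModule α β).snd = 0 := rfl
@[simp] theorem add_fst (m n : RepModule α β) : (m + n).fst = m.fst + n.fst := rfl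
@[simp] theorem add_snd (m n : RepModule α β) : (m + n).snd = m.snd + n.snd := rfl
@[simp] theorem neg_fst (m : RepModule α β) : (-m).fst = -m.fst := rfl
@[simp] theorem neg_snd (m : RepModule α β) : (-m).snd = -m.snd := rfl
@[simp] theorem smul_fst (r : KroneckerAlgebra k) (m : RepModule α β) :
    (r • m).fst = r.a • m.fst + (r.v.1 • α m.snd + r.v.2 • β m.snd) := rfl
@[simp] theorem smul_snd (r : KroneckerAlgebra k) (m : RepModule α β) :
    (r • m).snd = r.b • m.snd := rfl

instance : AddCommGroup (RepModule α β) where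
  add_assoc _ _ _ := by ext <;> simp [add_assoc]
  zero_add _ := by ext <;> simp
  add_zero _ := by ext <;> simp
  add_comm _ _ := by ext <;> simp [add_comm]
  neg_add_cancel _ := by ext <;> simp
  nsmul := nsmulRec
  zsmul := zsmulRec

instance : Module (KroneckerAlgebra k) (RepModule α β) where
  one_smul _ := by ext <;> simp
  mul_smul _ _ _ := by ext <;> simp <;> module
  smul_zero _ := by ext <;> simp
  smul_add _ _ _ := by ext <;> simp <;> module
  add_smul _ _ _ := by ext <;> simp <;> module
  zero_smul _ := by ext <;> simp

end RepModule

variable (k)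

/-- The simple regular module `V`: the representation `0, 1 : k ⇉ k`. -/
def simpleV : ModuleCat.{u} (KroneckerAlgebra k) :=
  ModuleCat.of _ (RepModule (0 : k →ₗ[k] k) LinearMap.id)

/-- The module `V_p`: the representation `1, x : k[x]/(p) ⇉ k[x]/(p)`. -/
noncomputable def simpleVp (p : k[X]) : ModuleCat.{u} (KroneckerAlgebra k) :=
  ModuleCat.of _ (RepModule (LinearMap.id : AdjoinRoot p →ₗ[k] AdjoinRoot p)
    (LinearMap.mulLeft k (AdjoinRoot.root p)))

/-- The set of modules `{V} ∪ {V_p | p ∈ Δ}`. -/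
def localizingSet (Δ : Set k[X]) : Set (ModuleCat.{u} (KroneckerAlgebra k)) :=
  {simpleV k} ∪ {U | ∃ p ∈ Δ, U = simpleVp k p}

/-- The smallest subring of `k(x)` that contains `k[x]` and `1 / p` for all `p ∈ Δ`. -/
noncomputable def invertedSubring (Δ : Set k[X]) : Subring (RatFunc k) :=
  Subring.closure (Set.range (algebraMap k[X] (RatFunc k)) ∪
    {f | ∃ p ∈ Δ, f = 1 / algebraMap k[X] (RatFunc k) p})

end KroneckerAlgebra

/-! The proof identifies the ring homomorphisms `θ : R → T` that invert the chosen presentations and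
shows that they are exactly those that factor, uniquely, through `M₂(D)`.

By a Yoneda argument, `T ⊗ f` is bijective iff `Hom(f, N)` is bijective for every `T`-module `N`
(`bijective_extendedMap_iff`). This condition depends only on the module that `f` presents, because
two projective presentations are homotopy equivalent (`isHomInverted_of_isHomInverted`). So each
module may be tested on its standard presentation, where the condition becomes a linear system:
given `h₁, h₂ : M₂ → e₁N`, solve `g₁α - a₁g₂ = h₁` and `g₁β - a₂g₂ = h₂` uniquely with `g₁ : M₁ →
e₁N` and `g₂ : M₂ → e₂N`. Here `e₁, e₂` are the vertex idempotents and `a₁, a₂` the arrows.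

For `V` the second equation determines `g₁`, and the first says that `a₁ : e₂N → e₁N` is bijective.
Hence inverting `V` means that `θ(a₁)` has an inverse `s`. Then `x` acts on `N` through the loop
`a₂s + sa₂`. For `V_p`, eliminating `g₁` leaves the operator `g ↦ g ∘ x - x • g` on `Hom_k(k[x]/(p),
N)`, which is bijective iff `p` acts bijectively on `N`
(`AdjoinRoot.existsUnique_sub_iff_bijective_smul`). So `V_p` is inverted iff `p(loop)` is a unit of
`T`.

Finally `e₁, a₁, s, e₂` are 2×2 matrix units in `T` that commute with the loop. Since `D` is the
localization of `k[x]` at the monoid generated by `Δ`, the data `(s, loop)` amount to one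
homomorphism `M₂(D) → T` (`existsUnique_comp_toMatrix_eq`). -/

/-! ### Extension of scalars and semilinear maps -/

section SemilinearMaps

variable {R S : Type u} [Ring R] [Ring S] (φ : R →+* S)

/-- The canonical `φ`-semilinear map `p ↦ 1 ⊗ p`. -/
noncomputable def extendedUnit (P : Type u) [AddCommGroup P] [Module R P] :
    P →ₛₗ[φ] ExtendedModule φ P where
  toFun p := (balancedRelations φ P).mkQ (1 ⊗ₜ[ℤ] p)
  map_add' p q := by rw [TensorProduct.tmul_add, map_add]
  map_smul' r p := by
    rw [← map_smul, eq_comm, ← sub_eq_zero, ← map_sub, Submodule.mkQ_apply,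
      Submodule.Quotient.mk_eq_zero]
    refine Submodule.subset_span ⟨1, r, p, ?_⟩
    rw [TensorProduct.smul_tmul', smul_eq_mul, mul_one, one_mul]

variable {φ}
variable {P Q : Type u} [AddCommGroup P] [Module R P] [AddCommGroup Q] [Module R Q]
variable {N : Type u} [AddCommGroup N] [Module S N]

theorem extendedModule_mk_tmul (s : S) (p : P) :
    (balancedRelations φ P).mkQ (s ⊗ₜ[ℤ] p) = s • extendedUnit φ P p := by
  change _ = s • (balancedRelations φ P).mkQ (1 ⊗ₜ[ℤ] p)
  rw [← map_smul, TensorProduct.smul_tmul', smul_eq_mul, mul_one]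

theorem extendedModule_hom_ext {g h : ExtendedModule φ P →ₗ[S] N}
    (H : ∀ p, g (extendedUnit φ P p) = h (extendedUnit φ P p)) : g = h := by
  refine Submodule.linearMap_qext _ (LinearMap.ext fun z => ?_)
  simp only [LinearMap.comp_apply]
  induction z using TensorProduct.induction_on with
  | zero => simp
  | tmul s p => rw [extendedModule_mk_tmul, map_smul, map_smul, H]
  | add x y hx hy => rw [map_add, map_add, map_add, hx, hy]

/-- The linear map on `S ⊗_R P` induced by a semilinear map on `P`. -/
noncomputable def extendedLift (g : P →ₛₗ[φ] N) : ExtendedModule φ P →ₗ[S] N :=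
  Submodule.liftQ (balancedRelations φ P)
    (TensorProduct.AlgebraTensorModule.lift
      { toFun := fun s => s • g.toAddMonoidHom.toIntLinearMap
        map_add' := fun s t => by ext; simp [add_smul]
        map_smul' := fun s t => by ext; simp [mul_smul] } : S ⊗[ℤ] P →ₗ[S] N) <| by
    rw [balancedRelations, Submodule.span_le]
    rintro _ ⟨s, r, p, rfl⟩
    simp [mul_smul]

@[simp]
theorem extendedLift_unit (g : P →ₛₗ[φ] N) (p : P) :
    extendedLift g (extendedUnit φ P p) = g p := by
  change extendedLift g ((balancedRelations φ P).mkQ ((1 : S) ⊗ₜ[ℤ] p)) = g p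
  rw [extendedLift, Submodule.mkQ_apply, Submodule.liftQ_apply]
  simp

@[simp]
theorem extendedMap_unit (f : P →ₗ[R] Q) (p : P) :
    extendedMap φ f (extendedUnit φ P p) = extendedUnit φ Q (f p) := by
  change (balancedRelations φ Q).mkQ (intTensorMap f (1 ⊗ₜ[ℤ] p)) = _
  simp [intTensorMap, extendedUnit]

/-- `Hom(f, N)` is bijective for every `S`-module `N`. -/
def IsHomInverted (φ : R →+* S) (f : P →ₗ[R] Q) : Prop :=
  ∀ (N : Type u) [AddCommGroup N] [Module S N],
    Function.Bijective fun g : Q →ₛₗ[φ] N => g.comp f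

/-- Yoneda: semilinear maps `P → N` are the `S`-linear maps `S ⊗ P → N`. In the converse, `N = S ⊗
P` produces a candidate inverse from the unit of `P`, and `N = S ⊗ Q` shows that it is two-sided. -/
theorem bijective_extendedMap_iff (f : P →ₗ[R] Q) :
    Function.Bijective (extendedMap φ f) ↔ IsHomInverted φ f := by
  constructor
  · intro hf N _ _
    let e := LinearEquiv.ofBijective _ hf
    refine ⟨fun g h hgh => ?_, fun g => ?_⟩
    · have : extendedLift g = extendedLift h := by
        refine LinearMap.ext fun z => ?_
        obtain ⟨z, rfl⟩ := hf.2 z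
        have : (extendedLift g).comp (extendedMap φ f) = (extendedLift h).comp (extendedMap φ f) :=
          extendedModule_hom_ext fun p => by simpa using LinearMap.congr_fun hgh p
        exact LinearMap.congr_fun this z
      ext q
      simpa using LinearMap.congr_fun this (extendedUnit φ Q q)
    · refine ⟨((extendedLift g).comp e.symm.toLinearMap).comp (extendedUnit φ Q), ?_⟩
      ext p
      have : e.symm (extendedUnit φ Q (f p)) = extendedUnit φ P p := by
        rw [LinearEquiv.symm_apply_eq, ← extendedMap_unit]; rfl
      simp [this]
  · intro H
    obtain ⟨g, hg⟩ := (H (ExtendedModule φ P)).2 (extendedUnit φ P)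
    have h1 : (extendedLift g).comp (extendedMap φ f) = LinearMap.id :=
      extendedModule_hom_ext fun p => by simpa using LinearMap.congr_fun hg p
    have h2 : ((extendedMap φ f).comp g) = extendedUnit φ Q := by
      refine (H (ExtendedModule φ Q)).1 (LinearMap.ext fun p => ?_)
      have := LinearMap.congr_fun hg p
      simp only [LinearMap.comp_apply] at this ⊢
      rw [this, extendedMap_unit]
    have h3 : (extendedMap φ f).comp (extendedLift g) = LinearMap.id :=
      extendedModule_hom_ext fun q => by simpa using LinearMap.congr_fun h2 q
    exact Function.bijective_iff_has_inverse.2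
      ⟨extendedLift g, LinearMap.congr_fun h1, LinearMap.congr_fun h3⟩

end SemilinearMaps

/-! ### Independence of the presentation -/

namespace FGProjPresentation

variable {R S : Type u} [Ring R] [Ring S] {φ : R →+* S}
variable {U : Type u} [AddCommGroup U] [Module R U]

theorem exists_lift (F : FGProjPresentation R U) {A : Type u} [AddCommGroup A] [Module R A]
    (g : A →ₗ[R] F.Q) (hg : ∀ a, F.proj (g a) = 0) : ∃ h : A →ₗ[R] F.P, F.map.comp h = g := by
  have hmem : ∀ a, g a ∈ LinearMap.range F.map := fun a => (F.exact (g a)).1 (hg a)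
  refine ⟨(LinearEquiv.ofInjective F.map F.injective).symm.toLinearMap.comp
    (g.codRestrict _ hmem), LinearMap.ext fun a => by simp⟩

/-- The identity of `U` lifts to chain maps `u : F → G` and `v : G → F`, and `uv` is homotopic to
the identity. Applying `Hom(-, N)` makes the complex of `G` a retract, up to homotopy, of that of
`F`. -/
theorem isHomInverted_of_isHomInverted (F G : FGProjPresentation R U)
    (hF : IsHomInverted φ F.map) : IsHomInverted φ G.map := by
  have aux (F G : FGProjPresentation R U) : ∃ (u : F.Q →ₗ[R] G.Q) (u₀ : F.P →ₗ[R] G.P),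
      G.proj.comp u = F.proj ∧ G.map.comp u₀ = u.comp F.map := by
    obtain ⟨u, hu⟩ := Module.projective_lifting_property G.proj F.proj G.surjective
    obtain ⟨u₀, hu₀⟩ := G.exists_lift (u.comp F.map) fun p => by
      have := LinearMap.congr_fun hu (F.map p)
      rw [LinearMap.comp_apply] at this
      rw [LinearMap.comp_apply, this]
      exact F.exact.apply_apply_eq_zero p
    exact ⟨u, u₀, hu, hu₀⟩
  obtain ⟨u, u₀, hu, hu₀⟩ := aux F G
  obtain ⟨v, v₀, hv, hv₀⟩ := aux G F
  -- The homotopy. Only the one on `G` is needed, since bijectivity is transferred from `F` to `G`.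
  obtain ⟨h, hh⟩ := G.exists_lift (u.comp v - LinearMap.id) fun q => by
    have h1 := LinearMap.congr_fun hu (v q)
    have h2 := LinearMap.congr_fun hv q
    simp only [LinearMap.comp_apply] at h1 h2
    simp [h1, h2]
  replace hu₀ : ∀ p, G.map (u₀ p) = u (F.map p) := LinearMap.congr_fun hu₀
  replace hv₀ : ∀ p, F.map (v₀ p) = v (G.map p) := LinearMap.congr_fun hv₀
  replace hh : ∀ q, G.map (h q) = u (v q) - q := LinearMap.congr_fun hh
  have hh' (p) : h (G.map p) = u₀ (v₀ p) - p :=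
    G.injective <| by rw [hh, map_sub, hu₀, hv₀]
  intro N _ _
  constructor
  · intro w₁ w₂ hw
    rw [← sub_eq_zero]
    generalize hw_def : w₁ - w₂ = w
    replace hw : ∀ p, w (G.map p) = 0 := fun p => by
      rw [← hw_def, LinearMap.sub_apply, sub_eq_zero]
      exact LinearMap.congr_fun hw p
    have hwu : w.comp u = 0 := (hF N).1 <| LinearMap.ext fun p => by
      simp [← hu₀, hw]
    ext q
    have h1 := LinearMap.congr_fun hwu (v q)
    have h2 := hw (h q)
    simp only [LinearMap.comp_apply, LinearMap.zero_apply] at h1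
    rw [hh, map_sub, h1, zero_sub, neg_eq_zero] at h2
    simpa using h2
  · intro g
    obtain ⟨w, hw⟩ := (hF N).2 (g.comp u₀)
    replace hw : ∀ p, w (F.map p) = g (u₀ p) := LinearMap.congr_fun hw
    refine ⟨w.comp v - g.comp h, LinearMap.ext fun p => ?_⟩
    simp [hh', ← hv₀, hw]

theorem bijective_extendedMap_iff (F G : FGProjPresentation R U) :
    Function.Bijective (extendedMap φ F.map) ↔ IsHomInverted φ G.map :=
  (_root_.bijective_extendedMap_iff _).trans
    ⟨isHomInverted_of_isHomInverted F G, isHomInverted_of_isHomInverted G F⟩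

end FGProjPresentation

/-! ### The operator `g ↦ g ∘ x - X • g` on linear maps from `k[x]/(p)` to a `k[X]`-module -/

section PolynomialModule

variable {k W : Type*} [Field k] [AddCommGroup W] [Module k[X] W] [Module k W]
  [IsScalarTower k k[X] W]

/-- On all of `k[X]` the inhomogeneous equation is always solvable: the values on the monomials `X ^
n` are found by recursion on `n`. -/
theorem Polynomial.exists_linearMap_X_mul (h : k[X] →ₗ[k] W) :
    ∃ δ : k[X] →ₗ[k] W, δ 1 = 0 ∧ ∀ f, δ (X * f) = (X : k[X]) • δ f + h f := by
  let s : ℕ → W := fun n => Nat.rec 0 (fun n w => (X : k[X]) • w + h (X ^ n)) n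
  let δ : k[X] →ₗ[k] W := (basisMonomials k).constr k s
  have hδ (n : ℕ) : δ (X ^ n) = s n := by
    rw [X_pow_eq_monomial, ← congrFun (coe_basisMonomials k) n, Module.Basis.constr_basis]
  refine ⟨δ, (congrArg δ (pow_zero X).symm).trans (hδ 0), fun f => ?_⟩
  induction f using Polynomial.induction_on' with
  | add f g hf hg => rw [mul_add, map_add, map_add, map_add, hf, hg, smul_add]; abel
  | monomial n c =>
    rw [← C_mul_X_pow_eq_monomial, C_mul', mul_smul_comm, ← pow_succ', map_smul, map_smul,
      map_smul, hδ, hδ, smul_comm, ← smul_add]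

theorem Polynomial.map_mul_of_map_X_mul {M : Type*} [AddCommGroup M] [Module k M]
    [Module k[X] M] [IsScalarTower k k[X] M]
    (g : M →ₗ[k] W) (hg : ∀ m, g ((X : k[X]) • m) = (X : k[X]) • g m) (f : k[X]) (m : M) :
    g (f • m) = f • g m := by
  induction f using Polynomial.induction_on generalizing m with
  | C c => rw [← algebraMap_eq, algebraMap_smul, algebraMap_smul, map_smul]
  | add f₁ f₂ h₁ h₂ => rw [add_smul, add_smul, map_add, h₁, h₂]
  | monomial n c ih => rw [pow_succ, ← mul_assoc, mul_smul, ih, hg, ← mul_smul]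

/-- Solutions of the homogeneous equation are the `k[X]`-linear maps `k[x]/(p) → W`, that is, the
elements of `W` killed by `p`. The obstruction to solving the inhomogeneous equation lies in `W /
pW`. -/
theorem AdjoinRoot.existsUnique_sub_iff_bijective_smul {p : k[X]} (hp : p.Monic)
    (hirr : Irreducible p) :
    (∀ h : AdjoinRoot p →ₗ[k] W, ∃! g : AdjoinRoot p →ₗ[k] W,
      ∀ z, g (root p * z) - (X : k[X]) • g z = h z) ↔
    Function.Bijective fun w : W => p • w := by
  have hmk : ∀ f : k[X], mk p (X * f) = root p * mk p f := fun f => by rw [map_mul, mk_X]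
  let π : k[X] →ₗ[k] AdjoinRoot p := (mkₐ p).toLinearMap
  have hπ : ∀ f, π f = mk p f := fun f => rfl
  constructor
  · intro H
    constructor
    · refine (injective_iff_map_eq_zero (DistribSMul.toAddMonoidHom W p)).2 fun w hw => ?_
      replace hw : p • w = 0 := hw
      let g₀ : k[X] →ₗ[k] W := (LinearMap.toSpanSingleton k[X] W w).restrictScalars k
      let g : AdjoinRoot p →ₗ[k] W :=
        Submodule.liftQ ((Ideal.span {p}).restrictScalars k) g₀ fun f hf => by
          obtain ⟨c, rfl⟩ := Ideal.mem_span_singleton'.1 hf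
          simp [g₀, mul_smul, hw]
      have hg : ∀ f, g (mk p f) = f • w := fun f => rfl
      have : g = 0 := by
        refine (H 0).unique (fun z => ?_) (fun z => by simp)
        induction z using AdjoinRoot.induction_on with
        | ih f => rw [← hmk, hg, hg, mul_smul, sub_self, LinearMap.zero_apply]
      simpa [this] using (hg 1).symm
    · intro w
      have hdeg : 0 < p.natDegree := hirr.natDegree_pos
      obtain ⟨n, hn⟩ : ∃ n, p.natDegree = n + 1 := ⟨p.natDegree - 1, by omega⟩
      -- With `deg p = n + 1`, this `h` reads off the coefficient of `X ^ n` in the reduced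
      -- representative. A solution `g` then agrees with `f ↦ f • g 1` on `X ^ i` for `i ≤ n` and is
      -- off by `w` at `X ^ (n + 1)`; as `p` is monic, `0 = g p = p • g 1 + w`.
      let h : AdjoinRoot p →ₗ[k] W :=
        ((lcoeff k n).comp (modByMonicHom hp)).smulRight w
      have hlt : ∀ i, i ≤ n → (X ^ i : k[X]) %ₘ p = X ^ i := by
        intro i hi
        refine (modByMonic_eq_self_iff hp).2 ?_
        rw [degree_X_pow, degree_eq_natDegree hp.ne_zero, hn]
        exact_mod_cast Nat.lt_succ_of_le hi
      have hh : ∀ i, i ≤ n → h (mk p (X ^ i)) = if i = n then w else 0 := by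
        intro i hi
        simp only [h, LinearMap.smulRight_apply, LinearMap.comp_apply, modByMonicHom_mk,
          hlt i hi, lcoeff_apply, coeff_X_pow, eq_comm (a := n), ite_smul, one_smul, zero_smul]
      obtain ⟨g, hg, -⟩ := H h
      have hpow : ∀ i, i ≤ n → g (mk p (X ^ i)) = (X ^ i : k[X]) • g 1 := by
        intro i
        induction i with
        | zero => intro _; simp
        | succ i ih =>
          intro hi
          have := hg (mk p (X ^ i))
          rw [← hmk, ← pow_succ', hh i (by omega), if_neg (by omega), sub_eq_zero,
            ih (by omega), ← mul_smul, ← pow_succ'] at this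
          exact this
      have htop : g (mk p (X ^ (n + 1))) = (X ^ (n + 1) : k[X]) • g 1 + w := by
        have := hg (mk p (X ^ n))
        rw [← hmk, ← pow_succ', hh n le_rfl, if_pos rfl, hpow n le_rfl, ← mul_smul,
          ← pow_succ', sub_eq_iff_eq_add] at this
        rw [this, add_comm]
      have hzero : g (mk p p) = p • g 1 + w := by
        have hsum := hp.as_sum
        rw [hn] at hsum
        have hlin : ∀ f : k[X], g (mk p f) = (g.comp π) f := fun f => rfl
        have hl : ∑ i ∈ Finset.range (n + 1), g (mk p (C (p.coeff i) * X ^ i)) =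
            ∑ i ∈ Finset.range (n + 1), (C (p.coeff i) * X ^ i : k[X]) • g 1 := by
          refine Finset.sum_congr rfl fun i hi => ?_
          rw [C_mul', hlin, map_smul, ← hlin, hpow i (by simpa [Nat.lt_succ_iff] using hi),
            smul_assoc]
        conv_lhs => enter [2, 2]; rw [hsum]
        conv_rhs => enter [1, 1]; rw [hsum]
        rw [map_add, map_add, htop, map_sum, map_sum, hl, add_smul, Finset.sum_smul]
        abel
      refine ⟨-g 1, ?_⟩
      rw [mk_self, map_zero] at hzero
      simp only [smul_neg]
      exact (eq_neg_of_add_eq_zero_right hzero.symm).symm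
  · intro hbij h
    refine existsUnique_of_exists_of_unique ?_ fun g₁ g₂ h₁ h₂ => ?_
    · obtain ⟨δ, hδ1, hδ⟩ := exists_linearMap_X_mul (h.comp π)
      -- The solution `f ↦ f • w + δ f` on `k[X]` must vanish at `p` in order to descend to the
      -- quotient.
      obtain ⟨w, hw⟩ := hbij.2 (-δ p)
      replace hw : p • w = -δ p := hw
      let g₀ : k[X] →ₗ[k] W := (LinearMap.toSpanSingleton k[X] W w).restrictScalars k + δ
      have hg₀ : ∀ f, g₀ f = f • w + δ f := fun f => rfl
      -- The inhomogeneous term vanishes on multiples of `p`, so `f ↦ g₀ (f * p)` is `k[X]`-linear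
      -- and vanishing at `p` suffices.
      have hE : ∀ f : k[X], (g₀.comp (LinearMap.mulRight k p)) (f • (1 : k[X])) =
          f • (g₀.comp (LinearMap.mulRight k p)) 1 := by
        refine fun f => map_mul_of_map_X_mul _ (fun m => ?_) f 1
        simp [hg₀, mul_assoc, hδ, hπ, mul_smul]
      let g : AdjoinRoot p →ₗ[k] W :=
        Submodule.liftQ ((Ideal.span {p}).restrictScalars k) g₀ fun f hf => by
          obtain ⟨c, rfl⟩ := Ideal.mem_span_singleton'.1 hf
          simpa [hg₀, hw] using hE c
      have hg : ∀ f, g (mk p f) = f • w + δ f := fun f => rfl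
      refine ⟨g, fun z => ?_⟩
      induction z using AdjoinRoot.induction_on with
      | ih f =>
        rw [← hmk, hg, hg, hδ, LinearMap.comp_apply, hπ, mul_smul, smul_add]
        abel
    · rw [← sub_eq_zero]
      generalize hd : g₁ - g₂ = g
      have hg : ∀ z, g (root p * z) = (X : k[X]) • g z := fun z => by
        have := (h₁ z).trans (h₂ z).symm
        rw [← hd, LinearMap.sub_apply, LinearMap.sub_apply, smul_sub, ← sub_eq_zero]
        rw [← sub_eq_zero] at this
        rw [← this]; abel
      have hE : ∀ f : k[X], (g.comp π) (f • (1 : k[X])) = f • (g.comp π) 1 := by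
        refine fun f => map_mul_of_map_X_mul _ (fun m => ?_) f 1
        rw [LinearMap.comp_apply, LinearMap.comp_apply, hπ, hπ, smul_eq_mul, hmk, hg]
      have hE' : ∀ f, g (mk p f) = f • g 1 := fun f => by simpa [hπ] using hE f
      have h1 : g 1 = 0 := hbij.1 (by simpa using (hE' p).symm)
      refine LinearMap.ext fun z => ?_
      induction z using AdjoinRoot.induction_on with
      | ih f => rw [hE', h1, smul_zero, LinearMap.zero_apply]

end PolynomialModule

/-! ### The standard presentation of a representation of the Kronecker quiver -/

namespace KroneckerAlgebra

/-! ### Idempotents, arrows and scalars of the Kronecker algebra -/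

section Basis

variable (k : Type u) [Field k]

/-- The scalar matrices. -/
def scalar : k →+* KroneckerAlgebra k where
  toFun c := ⟨c, 0, c⟩
  map_one' := rfl
  map_zero' := rfl
  map_mul' c d := by ext <;> simp
  map_add' c d := by ext <;> simp

/-- The idempotent of the first vertex. -/
def idem₁ : KroneckerAlgebra k := ⟨1, 0, 0⟩

/-- The idempotent of the second vertex. -/
def idem₂ : KroneckerAlgebra k := ⟨0, 0, 1⟩

/-- The first arrow. -/
def arrow₁ : KroneckerAlgebra k := ⟨0, (1, 0), 0⟩

/-- The second arrow. -/
def arrow₂ : KroneckerAlgebra k := ⟨0, (0, 1), 0⟩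

variable {k}

@[simp] theorem scalar_a (c : k) : (scalar k c).a = c := rfl
@[simp] theorem scalar_v (c : k) : (scalar k c).v = 0 := rfl
@[simp] theorem scalar_b (c : k) : (scalar k c).b = c := rfl
@[simp] theorem idem₁_a : (idem₁ k).a = 1 := rfl
@[simp] theorem idem₁_v : (idem₁ k).v = 0 := rfl
@[simp] theorem idem₁_b : (idem₁ k).b = 0 := rfl
@[simp] theorem idem₂_a : (idem₂ k).a = 0 := rfl
@[simp] theorem idem₂_v : (idem₂ k).v = 0 := rfl
@[simp] theorem idem₂_b : (idem₂ k).b = 1 := rfl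
@[simp] theorem arrow₁_a : (arrow₁ k).a = 0 := rfl
@[simp] theorem arrow₁_v : (arrow₁ k).v = (1, 0) := rfl
@[simp] theorem arrow₁_b : (arrow₁ k).b = 0 := rfl
@[simp] theorem arrow₂_a : (arrow₂ k).a = 0 := rfl
@[simp] theorem arrow₂_v : (arrow₂ k).v = (0, 1) := rfl
@[simp] theorem arrow₂_b : (arrow₂ k).b = 0 := rfl

theorem eq_sum (r : KroneckerAlgebra k) :
    r = scalar k r.a * idem₁ k + scalar k r.v.1 * arrow₁ k + scalar k r.v.2 * arrow₂ k
      + scalar k r.b * idem₂ k := by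
  ext <;> simp

theorem commute_scalar (c : k) (r : KroneckerAlgebra k) : Commute (scalar k c) r := by
  refine KroneckerAlgebra.ext (by simp [mul_comm]) (by simp) (by simp [mul_comm])

instance : Algebra k (KroneckerAlgebra k) :=
  (scalar k).toAlgebra' fun c r => commute_scalar c r

end Basis

namespace RepModule

variable {k M₁ M₂ : Type u} [Field k] [AddCommGroup M₁] [AddCommGroup M₂] [Module k M₁]
  [Module k M₂] {α β : M₂ →ₗ[k] M₁}

instance : Module k (RepModule α β) := Module.compHom _ (scalar k)

theorem scalar_smul_def (c : k) (m : RepModule α β) : c • m = scalar k c • m := rfl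

instance : IsScalarTower k (KroneckerAlgebra k) (RepModule α β) :=
  IsScalarTower.of_algebraMap_smul fun _ _ => rfl

@[simp] theorem field_smul_fst (c : k) (m : RepModule α β) : (c • m).fst = c • m.fst := by
  simp [scalar_smul_def]

@[simp] theorem field_smul_snd (c : k) (m : RepModule α β) : (c • m).snd = c • m.snd := by
  simp [scalar_smul_def]

variable (α β) in
/-- The underlying vector space of a representation. -/
def linearEquivProd : RepModule α β ≃ₗ[k] M₁ × M₂ where
  toFun m := (m.fst, m.snd)
  invFun m := ⟨m.1, m.2⟩
  map_add' _ _ := rfl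
  map_smul' c m := by simp
  left_inv _ := rfl
  right_inv _ := rfl

instance [Module.Finite k M₁] [Module.Finite k M₂] :
    Module.Finite (KroneckerAlgebra k) (RepModule α β) :=
  have : Module.Finite k (RepModule α β) := Module.Finite.equiv (linearEquivProd α β).symm
  Module.Finite.of_restrictScalars_finite k _ _

end RepModule

variable {k : Type u} [Field k]

/-- The projective module `P₁ ⊗ C ⊕ P₂ ⊗ E` for vector spaces `C` and `E`, where `P₁` and `P₂` are
the two columns of the Kronecker algebra. -/
abbrev ColumnModule (k C E : Type u) [Field k] [AddCommGroup C] [AddCommGroup E] [Module k C]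
    [Module k E] : Type u :=
  RepModule ((LinearMap.inr k C (E × E)).comp (LinearMap.inl k E E))
    ((LinearMap.inr k C (E × E)).comp (LinearMap.inr k E E))

namespace ColumnModule

variable {C E : Type u} [AddCommGroup C] [AddCommGroup E] [Module k C] [Module k E]
variable {T : Type u} [Ring T] {θ : KroneckerAlgebra k →+* T}
variable {N : Type u} [AddCommGroup N] [Module T N] [Module k N]

/-- The semilinear map on `P₁ ⊗ C ⊕ P₂ ⊗ E` with given restrictions to `C` and `E`. -/
def lift (hk : ∀ (c : k) (n : N), c • n = θ (scalar k c) • n)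
    (g₁ : C →ₗ[k] N) (g₂ : E →ₗ[k] N)
    (h₁ : ∀ x, θ (idem₁ k) • g₁ x = g₁ x) (h₂ : ∀ x, θ (idem₂ k) • g₂ x = g₂ x) :
    ColumnModule k C E →ₛₗ[θ] N where
  toFun m := g₁ m.fst.1 + θ (arrow₁ k) • g₂ m.fst.2.1 + θ (arrow₂ k) • g₂ m.fst.2.2 + g₂ m.snd
  map_add' m n := by simp; abel
  map_smul' r m := by
    -- Since `g₁` and `g₂` take values at their own vertices, identities in the algebra need
    -- checking only after right multiplication by the vertex idempotent.
    have e₁ (t : KroneckerAlgebra k) (x : C) : θ t • g₁ x = θ (t * idem₁ k) • g₁ x := by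
      rw [map_mul, mul_smul, h₁]
    have e₂ (t : KroneckerAlgebra k) (x : E) : θ t • g₂ x = θ (t * idem₂ k) • g₂ x := by
      rw [map_mul, mul_smul, h₂]
    have s₁ : g₁ (r.a • m.fst.1) = θ r • g₁ m.fst.1 := by
      rw [map_smul, hk, e₁, e₁ r]
      congr 2
      ext <;> simp
    have s₂ (t t' : KroneckerAlgebra k) (x : E) (c : k)
        (h : scalar k c * t' * idem₂ k = t * idem₂ k) :
        θ t' • g₂ (c • x) = θ t • g₂ x := by
      rw [map_smul, hk, smul_smul, ← map_mul, ← (commute_scalar c t').eq, e₂, e₂ t, h]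
    have s₃ : g₂ (r.b • m.snd) + θ (arrow₁ k) • g₂ (r.v.1 • m.snd)
        + θ (arrow₂ k) • g₂ (r.v.2 • m.snd) = θ r • g₂ m.snd := by
      rw [map_smul, map_smul, map_smul, hk, hk, hk, smul_smul, smul_smul, ← map_mul, ← map_mul,
        ← (commute_scalar _ _).eq, ← (commute_scalar _ _).eq, ← add_smul, ← add_smul, ← map_add,
        ← map_add, e₂, e₂ r]
      congr 2
      ext <;> simp
    rw [smul_add, smul_add, smul_add, smul_smul, smul_smul, ← map_mul, ← map_mul, ← s₁, ← s₃,
      ← s₂ (r * arrow₁ k) (arrow₁ k) _ r.a (by ext <;> simp),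
      ← s₂ (r * arrow₂ k) (arrow₂ k) _ r.a (by ext <;> simp)]
    simp
    abel

variable (hk : ∀ (c : k) (n : N), c • n = θ (scalar k c) • n)

/-- The restriction to `C` of a semilinear map on `P₁ ⊗ C ⊕ P₂ ⊗ E`. -/
def restrict₁ (g : ColumnModule k C E →ₛₗ[θ] N) : C →ₗ[k] N where
  toFun x := g ⟨(x, 0), 0⟩
  map_add' x y := by rw [← map_add]; congr 1; ext <;> simp
  map_smul' c x := by
    rw [RingHom.id_apply, hk, ← map_smulₛₗ]; congr 1; ext <;> simp

/-- The restriction to `E` of a semilinear map on `P₁ ⊗ C ⊕ P₂ ⊗ E`. -/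
def restrict₂ (g : ColumnModule k C E →ₛₗ[θ] N) : E →ₗ[k] N where
  toFun x := g ⟨0, x⟩
  map_add' x y := by rw [← map_add]; congr 1; ext <;> simp
  map_smul' c x := by
    rw [RingHom.id_apply, hk, ← map_smulₛₗ]; congr 1; ext <;> simp

theorem idem₁_smul_restrict₁ (g : ColumnModule k C E →ₛₗ[θ] N) (x : C) :
    θ (idem₁ k) • restrict₁ hk g x = restrict₁ hk g x := by
  change _ • g _ = g _
  rw [← map_smulₛₗ]; congr 1; ext <;> simp

theorem idem₂_smul_restrict₂ (g : ColumnModule k C E →ₛₗ[θ] N) (x : E) :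
    θ (idem₂ k) • restrict₂ hk g x = restrict₂ hk g x := by
  change _ • g _ = g _
  rw [← map_smulₛₗ]; congr 1; ext <;> simp

theorem apply_eq (g : ColumnModule k C E →ₛₗ[θ] N) (m : ColumnModule k C E) :
    g m = restrict₁ hk g m.fst.1 + θ (arrow₁ k) • restrict₂ hk g m.fst.2.1
      + θ (arrow₂ k) • restrict₂ hk g m.fst.2.2 + restrict₂ hk g m.snd := by
  change _ = g _ + _ • g _ + _ • g _ + g _
  rw [← map_smulₛₗ, ← map_smulₛₗ, ← map_add, ← map_add, ← map_add]
  congr 1; ext <;> simp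

theorem restrict₁_lift (g₁ : C →ₗ[k] N) (g₂ : E →ₗ[k] N) (h₁ h₂) :
    restrict₁ hk (lift hk g₁ g₂ h₁ h₂) = g₁ := by
  ext x; simp [restrict₁, lift]

theorem restrict₂_lift (g₁ : C →ₗ[k] N) (g₂ : E →ₗ[k] N) (h₁ h₂) :
    restrict₂ hk (lift hk g₁ g₂ h₁ h₂) = g₂ := by
  ext x; simp [restrict₂, lift]

theorem hom_ext {g h : ColumnModule k C E →ₛₗ[θ] N} (h₁ : restrict₁ hk g = restrict₁ hk h)
    (h₂ : restrict₂ hk g = restrict₂ hk h) : g = h := by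
  ext m
  rw [apply_eq hk g, apply_eq hk h, h₁, h₂]

/-- A map out of this module is a pair of `k`-linear maps into the two vertex spaces. Vector spaces
are projective, so both maps lift `k`-linearly; multiplying the lifts by the idempotents puts them
at the right vertices. -/
instance : Module.Projective (KroneckerAlgebra k) (ColumnModule k C E) := by
  refine Module.Projective.of_lifting_property fun {A B} _ _ _ _ f g hf => ?_
  let _ : Module k A := Module.compHom A (scalar k)
  let _ : Module k B := Module.compHom B (scalar k)
  have hkA (c : k) (n : A) : c • n = RingHom.id (KroneckerAlgebra k) (scalar k c) • n := rfl
  have hkB (c : k) (n : B) : c • n = RingHom.id (KroneckerAlgebra k) (scalar k c) • n := rfl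
  let f' : A →ₗ[k] B :=
    { toFun := f, map_add' := map_add f, map_smul' := fun c n => map_smul f (scalar k c) n }
  have mulIdem (e : KroneckerAlgebra k) : ∃ E : A →ₗ[k] A, ∀ x, E x = e • x :=
    ⟨{ toFun := fun x => e • x
       map_add' := smul_add e
       map_smul' := fun c x => by
        change e • scalar k c • x = scalar k c • e • x
        rw [smul_smul, smul_smul, (commute_scalar c e).eq] }, fun _ => rfl⟩
  obtain ⟨E₁, hE₁⟩ := mulIdem (idem₁ k)
  obtain ⟨E₂, hE₂⟩ := mulIdem (idem₂ k)
  have hi₁ : idem₁ k * idem₁ k = idem₁ k := by ext <;> simp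
  have hi₂ : idem₂ k * idem₂ k = idem₂ k := by ext <;> simp
  obtain ⟨l₁, hl₁⟩ := Module.projective_lifting_property f' (restrict₁ hkB g) hf
  obtain ⟨l₂, hl₂⟩ := Module.projective_lifting_property f' (restrict₂ hkB g) hf
  let L : ColumnModule k C E →ₗ[KroneckerAlgebra k] A :=
    lift hkA (E₁.comp l₁) (E₂.comp l₂) (fun x => by simp [hE₁, smul_smul, hi₁])
      (fun x => by simp [hE₂, smul_smul, hi₂])
  have hL₁ : restrict₁ hkA L = E₁.comp l₁ := restrict₁_lift hkA _ _ _ _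
  have hL₂ : restrict₂ hkA L = E₂.comp l₂ := restrict₂_lift hkA _ _ _ _
  refine ⟨L, hom_ext hkB (LinearMap.ext fun x => ?_) (LinearMap.ext fun x => ?_)⟩
  · have h1 : f (l₁ x) = restrict₁ hkB g x := LinearMap.congr_fun hl₁ x
    change f (restrict₁ hkA L x) = _
    rw [hL₁, LinearMap.comp_apply, hE₁, map_smul, h1]
    exact idem₁_smul_restrict₁ hkB g x
  · have h1 : f (l₂ x) = restrict₂ hkB g x := LinearMap.congr_fun hl₂ x
    change f (restrict₂ hkA L x) = _
    rw [hL₂, LinearMap.comp_apply, hE₂, map_smul, h1]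
    exact idem₂_smul_restrict₂ hkB g x

end ColumnModule

variable {M₁ M₂ : Type u} [AddCommGroup M₁] [AddCommGroup M₂] [Module k M₁] [Module k M₂]

/-- The map `P₁ ⊗ M₂² → P₁ ⊗ M₁ ⊕ P₂ ⊗ M₂` in the standard presentation of a representation. -/
def standardMap (α β : M₂ →ₗ[k] M₁) :
    ColumnModule k (M₂ × M₂) PUnit.{u + 1} →ₗ[KroneckerAlgebra k] ColumnModule k M₁ M₂ where
  toFun m := ⟨(α m.fst.1.1 + β m.fst.1.2, -m.fst.1), 0⟩
  map_add' m n := by ext <;> simp <;> abel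
  map_smul' r m := by ext <;> simp

/-- The standard presentation
`0 → P₁ ⊗ M₂² → P₁ ⊗ M₁ ⊕ P₂ ⊗ M₂ → M → 0` of a finite-dimensional representation. -/
def standardPresentation [Module.Finite k M₁] [Module.Finite k M₂] (α β : M₂ →ₗ[k] M₁) :
    FGProjPresentation (KroneckerAlgebra k) (RepModule α β) where
  P := ColumnModule k (M₂ × M₂) PUnit
  Q := ColumnModule k M₁ M₂
  map := standardMap α β
  proj :=
    { toFun := fun m => ⟨m.fst.1 + α m.fst.2.1 + β m.fst.2.2, m.snd⟩
      map_add' := fun m n => by ext <;> simp; abel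
      map_smul' := fun r m => by ext <;> simp; abel }
  injective m n h := by
    have h' : m.fst.1 = n.fst.1 := neg_injective (congrArg (fun z => z.fst.2) h)
    exact RepModule.ext (Prod.ext h' (Subsingleton.elim _ _)) rfl
  exact m := by
    constructor
    · intro h
      have h1 : m.fst.1 + α m.fst.2.1 + β m.fst.2.2 = 0 := congrArg RepModule.fst h
      have h2 : m.snd = 0 := congrArg RepModule.snd h
      refine ⟨⟨(-m.fst.2, 0), 0⟩, ?_⟩
      ext
      · have := eq_neg_of_add_eq_zero_left ((add_assoc _ _ _).symm.trans h1)
        simp [standardMap, this]; abel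
      · simp [standardMap]
      · simp [standardMap]
      · simp [standardMap, h2]
    · rintro ⟨n, rfl⟩
      ext <;> simp [standardMap]
  surjective m := ⟨⟨(m.fst, 0), m.snd⟩, by ext <;> simp⟩

/-! ### The linear system attached to a representation -/

section Criterion

variable {T : Type u} [Ring T] {θ : KroneckerAlgebra k →+* T}
variable {N : Type u} [AddCommGroup N] [Module T N] [Module k N]

/-- A semilinear map on either projective is determined by its restrictions to the generating
spaces, and composition with `standardMap` becomes `(g₁, g₂) ↦ (g₁α - a₁g₂, g₁β - a₂g₂)`. -/
theorem bijective_comp_standardMap_iff (α β : M₂ →ₗ[k] M₁)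
    (hk : ∀ (c : k) (n : N), c • n = θ (scalar k c) • n) :
    (Function.Bijective fun g : ColumnModule k M₁ M₂ →ₛₗ[θ] N =>
      g.comp (standardMap α β)) ↔
    ∀ h₁ h₂ : M₂ →ₗ[k] N, (∀ m, θ (idem₁ k) • h₁ m = h₁ m) → (∀ m, θ (idem₁ k) • h₂ m = h₂ m) →
      ∃! g : (M₁ →ₗ[k] N) × (M₂ →ₗ[k] N),
        (∀ m, θ (idem₁ k) • g.1 m = g.1 m) ∧ (∀ m, θ (idem₂ k) • g.2 m = g.2 m) ∧
        (∀ m, g.1 (α m) - θ (arrow₁ k) • g.2 m = h₁ m) ∧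
        (∀ m, g.1 (β m) - θ (arrow₂ k) • g.2 m = h₂ m) := by
  have key (g : ColumnModule k M₁ M₂ →ₛₗ[θ] N) (g' : ColumnModule k (M₂ × M₂) PUnit →ₛₗ[θ] N) :
      g.comp (standardMap α β) = g' ↔
      (∀ m, ColumnModule.restrict₁ hk g (α m) - θ (arrow₁ k) • ColumnModule.restrict₂ hk g m =
        ColumnModule.restrict₁ hk g' (m, 0)) ∧
      (∀ m, ColumnModule.restrict₁ hk g (β m) - θ (arrow₂ k) • ColumnModule.restrict₂ hk g m =
        ColumnModule.restrict₁ hk g' (0, m)) := by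
    have hval (x : M₂ × M₂) :
        ColumnModule.restrict₁ hk (C := M₂ × M₂) (E := PUnit)
          (g.comp (standardMap α β)) x =
        (ColumnModule.restrict₁ hk g (α x.1) - θ (arrow₁ k) • ColumnModule.restrict₂ hk g x.1) +
        (ColumnModule.restrict₁ hk g (β x.2) - θ (arrow₂ k) • ColumnModule.restrict₂ hk g x.2) := by
      change g ⟨(α x.1 + β x.2, -x), 0⟩ = _
      rw [ColumnModule.apply_eq hk]
      simp
      abel
    constructor
    · rintro rfl
      refine ⟨fun m => ?_, fun m => ?_⟩ <;> rw [hval] <;> simp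
    · rintro ⟨h1, h2⟩
      refine ColumnModule.hom_ext hk (LinearMap.ext fun x => ?_) (LinearMap.ext fun x => ?_)
      · rw [hval, h1, h2, ← map_add]; simp
      · rw [Subsingleton.elim x 0, map_zero, map_zero]
  constructor
  · intro hb h₁ h₂ hh₁ hh₂
    let g' : ColumnModule k (M₂ × M₂) PUnit →ₛₗ[θ] N :=
      ColumnModule.lift hk (h₁.coprod h₂) 0 (fun x => by simp [hh₁, hh₂]) (fun x => by simp)
    have hg' : ColumnModule.restrict₁ hk g' = h₁.coprod h₂ := ColumnModule.restrict₁_lift hk _ _ _ _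
    obtain ⟨g, hg⟩ := hb.2 g'
    obtain ⟨hg1, hg2⟩ := (key g g').1 hg
    refine ⟨⟨ColumnModule.restrict₁ hk g, ColumnModule.restrict₂ hk g⟩,
      ⟨ColumnModule.idem₁_smul_restrict₁ hk g, ColumnModule.idem₂_smul_restrict₂ hk g,
        fun m => ?_, fun m => ?_⟩, ?_⟩
    · rw [hg1, hg']; simp
    · rw [hg2, hg']; simp
    · rintro ⟨l₁, l₂⟩ ⟨hl₁, hl₂, hl₃, hl₄⟩
      have : ColumnModule.lift hk l₁ l₂ hl₁ hl₂ = g := by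
        refine hb.1 (Eq.trans ?_ hg.symm)
        refine (key _ g').2 ?_
        rw [hg', ColumnModule.restrict₁_lift, ColumnModule.restrict₂_lift]
        exact ⟨fun m => by simpa using hl₃ m, fun m => by simpa using hl₄ m⟩
      rw [← this, ColumnModule.restrict₁_lift, ColumnModule.restrict₂_lift]
  · intro H
    refine (Function.bijective_iff_existsUnique _).2 fun g' => ?_
    obtain ⟨⟨l₁, l₂⟩, ⟨hl₁, hl₂, hl₃, hl₄⟩, huniq⟩ :=
      H ((ColumnModule.restrict₁ hk (C := M₂ × M₂) (E := PUnit) g').comp (LinearMap.inl k M₂ M₂))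
        ((ColumnModule.restrict₁ hk (C := M₂ × M₂) (E := PUnit) g').comp (LinearMap.inr k M₂ M₂))
        (fun m => ColumnModule.idem₁_smul_restrict₁ hk g' _)
        (fun m => ColumnModule.idem₁_smul_restrict₁ hk g' _)
    refine ⟨ColumnModule.lift hk l₁ l₂ hl₁ hl₂, (key _ _).2 ?_, fun g hg => ?_⟩
    · rw [ColumnModule.restrict₁_lift, ColumnModule.restrict₂_lift]
      exact ⟨hl₃, hl₄⟩
    · obtain ⟨hg1, hg2⟩ := (key g g').1 hg
      have := huniq ⟨ColumnModule.restrict₁ hk g, ColumnModule.restrict₂ hk g⟩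
        ⟨ColumnModule.idem₁_smul_restrict₁ hk g, ColumnModule.idem₂_smul_restrict₂ hk g, hg1, hg2⟩
      refine ColumnModule.hom_ext hk ?_ ?_
      · rw [ColumnModule.restrict₁_lift]; exact congrArg Prod.fst this
      · rw [ColumnModule.restrict₂_lift]; exact congrArg Prod.snd this

end Criterion

end KroneckerAlgebra

/-! ### Inverting the regular simple modules -/

namespace KroneckerAlgebra

variable {k : Type u} [Field k]

/-! ### Relations in `T` once the first arrow is invertible -/

section Relations

variable {T : Type u} [Ring T] (θ : KroneckerAlgebra k →+* T)

theorem idem₁_mul_idem₁ : idem₁ k * idem₁ k = idem₁ k := by ext <;> simp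
theorem idem₂_mul_idem₂ : idem₂ k * idem₂ k = idem₂ k := by ext <;> simp
theorem idem₁_mul_idem₂ : idem₁ k * idem₂ k = 0 := by ext <;> simp
theorem idem₂_mul_idem₁ : idem₂ k * idem₁ k = 0 := by ext <;> simp
theorem idem₁_mul_arrow₁ : idem₁ k * arrow₁ k = arrow₁ k := by ext <;> simp
theorem idem₁_mul_arrow₂ : idem₁ k * arrow₂ k = arrow₂ k := by ext <;> simp
theorem idem₂_mul_arrow₂ : idem₂ k * arrow₂ k = 0 := by ext <;> simp
theorem arrow₁_mul_idem₂ : arrow₁ k * idem₂ k = arrow₁ k := by ext <;> simp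
theorem arrow₂_mul_idem₂ : arrow₂ k * idem₂ k = arrow₂ k := by ext <;> simp
theorem arrow₂_mul_idem₁ : arrow₂ k * idem₁ k = 0 := by ext <;> simp
theorem arrow₁_mul_arrow₂ : arrow₁ k * arrow₂ k = 0 := by ext <;> simp
theorem idem₁_add_idem₂ : idem₁ k + idem₂ k = 1 := by ext <;> simp

/-- `s` is an inverse of the first arrow, as a map between the two vertices. -/
structure IsArrowInverse (s : T) : Prop where
  arrow_mul : θ (arrow₁ k) * s = θ (idem₁ k)
  mul_arrow : s * θ (arrow₁ k) = θ (idem₂ k)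
  idem_mul : θ (idem₂ k) * s = s
  mul_idem : s * θ (idem₁ k) = s

/-- The action of the variable on `T`, once the first arrow is invertible. -/
def loop (s : T) : T := θ (arrow₂ k) * s + s * θ (arrow₂ k)

theorem commute_map_scalar (c : k) (r : KroneckerAlgebra k) : Commute (θ (scalar k c)) (θ r) :=
  (commute_scalar c r).map θ

namespace IsArrowInverse

variable {θ} {s : T}

theorem mul_idem₂ (hs : IsArrowInverse θ s) : s * θ (idem₂ k) = 0 := by
  rw [← hs.mul_idem, mul_assoc, ← map_mul, idem₁_mul_idem₂, map_zero, mul_zero]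

theorem idem₁_mul (hs : IsArrowInverse θ s) : θ (idem₁ k) * s = 0 := by
  rw [← hs.idem_mul, ← mul_assoc, ← map_mul, idem₁_mul_idem₂, map_zero, zero_mul]

theorem mul_self (hs : IsArrowInverse θ s) : s * s = 0 := by
  rw [← hs.mul_idem, mul_assoc, hs.mul_idem, hs.idem₁_mul, mul_zero]

/-- The loop is `arrow₂ * s` at the first vertex and `s * arrow₂` at the second. Taking both
summands makes it commute with all four matrix units, as a scalar matrix must. -/
theorem arrow₁_mul_loop (hs : IsArrowInverse θ s) : θ (arrow₁ k) * loop θ s = θ (arrow₂ k) := by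
  rw [loop, mul_add, ← mul_assoc, ← mul_assoc, ← map_mul, arrow₁_mul_arrow₂, map_zero, zero_mul,
    zero_add, hs.arrow_mul, ← map_mul, idem₁_mul_arrow₂]

theorem loop_mul_arrow₁ (hs : IsArrowInverse θ s) : loop θ s * θ (arrow₁ k) = θ (arrow₂ k) := by
  have : arrow₂ k * arrow₁ k = 0 := by ext <;> simp
  rw [loop, add_mul, mul_assoc, mul_assoc, hs.mul_arrow, ← map_mul, ← map_mul, arrow₂_mul_idem₂,
    this, map_zero, mul_zero, add_zero]

theorem idem₁_mul_loop (hs : IsArrowInverse θ s) : θ (idem₁ k) * loop θ s = θ (arrow₂ k) * s := by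
  rw [loop, mul_add, ← mul_assoc, ← mul_assoc, ← map_mul, idem₁_mul_arrow₂, hs.idem₁_mul,
    zero_mul, add_zero]

theorem loop_mul_idem₁ (hs : IsArrowInverse θ s) : loop θ s * θ (idem₁ k) = θ (arrow₂ k) * s := by
  rw [loop, add_mul, mul_assoc, mul_assoc, ← map_mul, arrow₂_mul_idem₁, hs.mul_idem,
    map_zero, mul_zero, add_zero]

theorem idem₂_mul_loop (hs : IsArrowInverse θ s) : θ (idem₂ k) * loop θ s = s * θ (arrow₂ k) := by
  rw [loop, mul_add, ← mul_assoc, ← mul_assoc, ← map_mul, idem₂_mul_arrow₂, hs.idem_mul,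
    map_zero, zero_mul, zero_add]

theorem loop_mul_idem₂ (hs : IsArrowInverse θ s) : loop θ s * θ (idem₂ k) = s * θ (arrow₂ k) := by
  rw [loop, add_mul, mul_assoc, mul_assoc, ← map_mul, arrow₂_mul_idem₂, hs.mul_idem₂,
    mul_zero, zero_add]

theorem commute_inverse_loop (hs : IsArrowInverse θ s) : Commute s (loop θ s) := by
  rw [commute_iff_eq, loop, mul_add, add_mul, ← mul_assoc s s, hs.mul_self, mul_assoc _ s s,
    hs.mul_self, zero_mul, mul_zero, zero_add, add_zero, mul_assoc]

/-- The inverse of an element commuting with the scalars commutes with them too; the vertex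
idempotents play the role of `1`. -/
theorem commute_scalar_inverse (hs : IsArrowInverse θ s) (c : k) : Commute (θ (scalar k c)) s := by
  rw [commute_iff_eq]
  calc θ (scalar k c) * s = θ (scalar k c) * (θ (idem₂ k) * s) := by rw [hs.idem_mul]
    _ = s * θ (scalar k c) * (θ (arrow₁ k) * s) := by
      rw [← mul_assoc, (commute_map_scalar θ c _).eq, ← hs.mul_arrow, mul_assoc s,
        ← (commute_map_scalar θ c _).eq]
      simp only [mul_assoc]
    _ = s * θ (scalar k c) := by
      rw [hs.arrow_mul, mul_assoc, (commute_map_scalar θ c _).eq, ← mul_assoc, hs.mul_idem]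

theorem commute_scalar_loop (hs : IsArrowInverse θ s) (c : k) :
    Commute (θ (scalar k c)) (loop θ s) :=
  ((commute_map_scalar θ c _).mul_right (hs.commute_scalar_inverse c)).add_right
    ((hs.commute_scalar_inverse c).mul_right (commute_map_scalar θ c _))

/-- The homomorphism `k[X] → T` that maps the variable to the loop. -/
noncomputable def evalLoop (hs : IsArrowInverse θ s) : k[X] →+* T :=
  eval₂RingHom' (θ.comp (scalar k)) (loop θ s) hs.commute_scalar_loop

theorem evalLoop_X (hs : IsArrowInverse θ s) : hs.evalLoop X = loop θ s := eval₂_X _ _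

theorem evalLoop_C (hs : IsArrowInverse θ s) (c : k) : hs.evalLoop (C c) = θ (scalar k c) :=
  eval₂_C _ _

theorem commute_evalLoop (hs : IsArrowInverse θ s) {t : T} (h₁ : ∀ c, Commute (θ (scalar k c)) t)
    (h₂ : Commute (loop θ s) t) (f : k[X]) : Commute (hs.evalLoop f) t := by
  induction f using Polynomial.induction_on' with
  | add f g hf hg => rw [map_add]; exact hf.add_left hg
  | monomial n c =>
    rw [← C_mul_X_pow_eq_monomial, map_mul, map_pow, evalLoop_C, evalLoop_X]
    exact (h₁ c).mul_left (h₂.pow_left n)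

theorem eq_of_isArrowInverse (hs : IsArrowInverse θ s) {s' : T} (hs' : IsArrowInverse θ s') :
    s = s' := by
  rw [← hs.mul_idem, ← hs'.arrow_mul, ← mul_assoc, hs.mul_arrow, hs'.idem_mul]

end IsArrowInverse

end Relations

/-! ### When `V` and `V_p` are inverted -/

section Inverting

variable {T : Type u} [Ring T] {θ : KroneckerAlgebra k →+* T}

section

variable {N : Type u} [AddCommGroup N] [Module T N] [Module k N]

/-- Multiplication by an element that commutes with the scalars, as a linear map. -/
def smulLinear (hk : ∀ (c : k) (n : N), c • n = θ (scalar k c) • n) (t : T)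
    (ht : ∀ c, Commute (θ (scalar k c)) t) : N →ₗ[k] N where
  toFun n := t • n
  map_add' := smul_add t
  map_smul' c n := by
    rw [RingHom.id_apply, hk, hk, smul_smul, smul_smul, (ht c).eq]

end

theorem isHomInverted_standardMap_zero_id_iff :
    IsHomInverted θ (standardMap (0 : k →ₗ[k] k) LinearMap.id) ↔ ∃ s, IsArrowInverse θ s := by
  constructor
  · intro H
    let _ : Module k T := Module.compHom T (θ.comp (scalar k))
    have hk (c : k) (n : T) : c • n = θ (scalar k c) • n := rfl
    have H' := (bijective_comp_standardMap_iff _ _ hk).1 (H T)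
    have hE (r : KroneckerAlgebra k) (c : k) (t : T) (h : θ r * t = t) :
        θ r * (c • t) = c • t := by
      rw [hk, smul_eq_mul, ← mul_assoc, ← (commute_map_scalar θ c r).eq, mul_assoc, h]
    -- Uniqueness gives left cancellation of `arrow₁`: such a `t` yields the homogeneous solution `1
    -- ↦ (arrow₂ * t, t)`.
    have hinj (t : T) (h₁ : θ (idem₂ k) * t = t) (h₂ : θ (arrow₁ k) * t = 0) : t = 0 := by
      have := (H' 0 0 (by simp) (by simp)).unique
        (y₁ := (LinearMap.toSpanSingleton k T (θ (arrow₂ k) * t),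
          LinearMap.toSpanSingleton k T t)) (y₂ := 0)
        ⟨fun m => hE _ _ _ (by rw [← mul_assoc, ← map_mul, idem₁_mul_arrow₂]),
          fun m => hE _ _ _ h₁, fun m => ?_, fun m => ?_⟩ (by simp)
      · simpa using LinearMap.congr_fun (congrArg Prod.snd this) (1 : k)
      · simp [hk, ← mul_assoc, ← (commute_map_scalar θ m (arrow₁ k)).eq]
        simp [mul_assoc, h₂]
      · simp [hk, ← mul_assoc, ← (commute_map_scalar θ m (arrow₂ k)).eq]
    -- Since `α = 0`, the first equation at `1` reads `-arrow₁ * g₂ 1 = -idem₁`, so `g₂ 1` is a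
    -- right inverse; `hinj` makes it two-sided.
    obtain ⟨⟨g₁, g₂⟩, ⟨-, hg₂, hg₃, -⟩, -⟩ :=
      H' (-LinearMap.toSpanSingleton k T (θ (idem₁ k))) 0
        (fun m => by
          have := hE (idem₁ k) m (θ (idem₁ k)) (by rw [← map_mul, idem₁_mul_idem₁])
          simpa using this) (by simp)
    have h₁ : θ (arrow₁ k) * g₂ 1 = θ (idem₁ k) := by simpa using hg₃ 1
    have h₂ : θ (idem₂ k) * g₂ 1 = g₂ 1 := hg₂ 1
    refine ⟨g₂ 1, h₁, ?_, h₂, ?_⟩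
    · rw [← sub_eq_zero]
      refine hinj _ ?_ ?_
      · rw [mul_sub, ← mul_assoc, h₂, ← map_mul, idem₂_mul_idem₂]
      · rw [mul_sub, ← mul_assoc, h₁, ← map_mul, ← map_mul, idem₁_mul_arrow₁, arrow₁_mul_idem₂,
          sub_self]
    · rw [← sub_eq_zero]
      refine hinj _ ?_ ?_
      · rw [mul_sub, ← mul_assoc, h₂]
      · rw [mul_sub, ← mul_assoc, h₁, ← map_mul, idem₁_mul_idem₁, sub_self]
  · rintro ⟨s, hs⟩ N _ _
    let _ : Module k N := Module.compHom N (θ.comp (scalar k))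
    have hk (c : k) (n : N) : c • n = θ (scalar k c) • n := rfl
    refine (bijective_comp_standardMap_iff _ _ hk).2 fun h₁ h₂ hh₁ hh₂ => ?_
    let g₂ : k →ₗ[k] N := -(smulLinear hk s hs.commute_scalar_inverse).comp h₁
    have hg₂ (m : k) : g₂ m = -(s • h₁ m) := rfl
    let g₁ : k →ₗ[k] N :=
      h₂ + (smulLinear hk (θ (arrow₂ k)) fun c => commute_map_scalar θ c _).comp g₂
    have hg₁ (m : k) : g₁ m = h₂ m + θ (arrow₂ k) • g₂ m := rfl
    refine ⟨(g₁, g₂), ⟨fun m => ?_, fun m => ?_, fun m => ?_, fun m => ?_⟩, ?_⟩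
    · simp only [hg₁]
      rw [smul_add, hh₂, smul_smul, ← map_mul, idem₁_mul_arrow₂]
    · simp only [hg₂]
      rw [smul_neg, smul_smul, hs.idem_mul]
    · simp only [hg₂]
      rw [LinearMap.zero_apply, map_zero, smul_neg, smul_smul, hs.arrow_mul, hh₁]
      simp
    · simp only [hg₁, LinearMap.id_apply]
      abel
    · rintro ⟨l₁, l₂⟩ ⟨hl₁, hl₂, hl₃, hl₄⟩
      have e₂ : l₂ = g₂ := by
        ext
        have := hl₃ 1
        simp only [LinearMap.zero_apply, map_zero, zero_sub] at this
        rw [hg₂, ← this, smul_neg, neg_neg, smul_smul, hs.mul_arrow]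
        exact (hl₂ 1).symm
      subst e₂
      have e₁ : l₁ = g₁ := by
        ext
        rw [hg₁, ← sub_eq_iff_eq_add]
        exact hl₄ 1
      rw [e₁]

/-- For an `N` on which the first arrow is invertible, the criterion for the representation
`1, x : k[x]/(p) ⇉ k[x]/(p)` only involves the loop. -/
theorem bijective_comp_standardMap_id_mulLeft_iff {s : T} (hs : IsArrowInverse θ s) (p : k[X])
    {N : Type u} [AddCommGroup N] [Module T N] [Module k N]
    (hk : ∀ (c : k) (n : N), c • n = θ (scalar k c) • n) :
    (Function.Bijective fun g : ColumnModule k (AdjoinRoot p) (AdjoinRoot p) →ₛₗ[θ] N =>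
      g.comp (standardMap LinearMap.id (LinearMap.mulLeft k (AdjoinRoot.root p)))) ↔
    ∀ h : AdjoinRoot p →ₗ[k] N, ∃! g : AdjoinRoot p →ₗ[k] N,
      ∀ z, g (AdjoinRoot.root p * z) - loop θ s • g z = h z := by
  rw [bijective_comp_standardMap_iff _ _ hk]
  let mE (r : KroneckerAlgebra k) : N →ₗ[k] N :=
    smulLinear hk (θ r) fun c => commute_map_scalar θ c r
  let mS : N →ₗ[k] N := smulLinear hk s hs.commute_scalar_inverse
  have hmE (r : KroneckerAlgebra k) (n : N) : mE r n = θ r • n := rfl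
  have hmS (n : N) : mS n = s • n := rfl
  have hsplit (n : N) : n = θ (idem₁ k) • n + θ (idem₂ k) • n := by
    rw [← add_smul, ← map_add, idem₁_add_idem₂, map_one, one_smul]
  have hloop (n : N) (hn : θ (idem₂ k) • n = n) : loop θ s • n = s • θ (arrow₂ k) • n := by
    conv_lhs => rw [← hn]
    rw [smul_smul, hs.loop_mul_idem₂, mul_smul]
  constructor
  · intro H
    -- The system with zero first right-hand side gives `g₁ = arrow₁ • g₂`, which eliminates `g₁`.
    have hex (h : AdjoinRoot p →ₗ[k] N) (hh : ∀ z, θ (idem₁ k) • h z = h z) :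
        ∃ g : AdjoinRoot p →ₗ[k] N, (∀ z, θ (idem₂ k) • g z = g z) ∧
          ∀ z, θ (arrow₁ k) • g (AdjoinRoot.root p * z) - θ (arrow₂ k) • g z = h z := by
      obtain ⟨⟨g₁, g₂⟩, ⟨-, hg₂, hg₃, hg₄⟩, -⟩ := H 0 h (by simp) hh
      refine ⟨g₂, hg₂, fun z => ?_⟩
      rw [← hg₄, ← sub_eq_zero.1 (hg₃ _)]
      rfl
    have huniq (g : AdjoinRoot p →ₗ[k] N) (hg : ∀ z, θ (idem₂ k) • g z = g z)
        (hg' : ∀ z, θ (arrow₁ k) • g (AdjoinRoot.root p * z) = θ (arrow₂ k) • g z) : g = 0 := by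
      have := (H 0 0 (by simp) (by simp)).unique (y₁ := ((mE (arrow₁ k)).comp g, g)) (y₂ := 0)
        ⟨fun z => ?_, hg, fun z => ?_, fun z => ?_⟩ (by simp)
      · exact congrArg Prod.snd this
      · simp [hmE, smul_smul, ← map_mul, idem₁_mul_arrow₁]
      · simp [hmE]
      · simp [hmE, hg']
    intro h
    refine existsUnique_of_exists_of_unique ?_ fun g₁ g₂ h₁ h₂ => ?_
    -- The loop equation splits along `N = idem₁ N ⊕ idem₂ N`. Each half is transported by `arrow₁`
    -- or `s` to the form solved by `hex`.
    · obtain ⟨g₂, hg₂, hg₂'⟩ := hex ((mE (arrow₁ k)).comp h) fun z => by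
        simp [hmE, smul_smul, ← map_mul, idem₁_mul_arrow₁]
      obtain ⟨g₁, hg₁, hg₁'⟩ := hex ((mE (idem₁ k)).comp h) fun z => by
        simp [hmE, smul_smul, ← map_mul, idem₁_mul_idem₁]
      refine ⟨(mE (arrow₁ k)).comp g₁ + g₂, fun z => ?_⟩
      have e₁ : θ (arrow₁ k) • g₁ (AdjoinRoot.root p * z) - loop θ s • θ (arrow₁ k) • g₁ z =
          θ (idem₁ k) • h z := by
        rw [smul_smul (loop θ s), hs.loop_mul_arrow₁, hg₁']; rfl
      have e₂ : g₂ (AdjoinRoot.root p * z) - loop θ s • g₂ z = θ (idem₂ k) • h z := by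
        have := congrArg (s • ·) (hg₂' z)
        simp only [LinearMap.comp_apply, hmE, smul_sub] at this
        rwa [smul_smul s, smul_smul s (θ (arrow₁ k)), hs.mul_arrow, hg₂,
          ← hloop _ (hg₂ z)] at this
      rw [hsplit (h z), ← e₁, ← e₂]
      simp only [LinearMap.add_apply, LinearMap.comp_apply, hmE, smul_add]
      abel
    · rw [← sub_eq_zero]
      generalize hd : g₁ - g₂ = g
      have hg (z) : g (AdjoinRoot.root p * z) = loop θ s • g z := by
        have := sub_eq_zero.2 ((h₁ z).trans (h₂ z).symm)
        rw [← hd, LinearMap.sub_apply, LinearMap.sub_apply, smul_sub, ← sub_eq_zero, ← this]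
        abel
      have e₂ := huniq ((mE (idem₂ k)).comp g)
        (fun z => by simp [hmE, smul_smul, ← map_mul, idem₂_mul_idem₂])
        (fun z => by
          simp only [LinearMap.comp_apply, hmE, hg, smul_smul]
          rw [← mul_assoc, ← map_mul, ← map_mul, arrow₁_mul_idem₂, arrow₂_mul_idem₂,
            hs.arrow₁_mul_loop])
      have e₁ := huniq (mS.comp g)
        (fun z => by simp [hmS, smul_smul, hs.idem_mul])
        (fun z => by
          simp only [LinearMap.comp_apply, hmS, hg, smul_smul]
          rw [← mul_assoc, hs.arrow_mul, hs.idem₁_mul_loop])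
      refine LinearMap.ext fun z => ?_
      have h1 : s • g z = 0 := LinearMap.congr_fun e₁ z
      have h2 : θ (idem₂ k) • g z = 0 := LinearMap.congr_fun e₂ z
      rw [hsplit (g z), h2, ← hs.arrow_mul, mul_smul, h1, smul_zero, add_zero,
        LinearMap.zero_apply]
  · intro H h₁ h₂ hh₁ hh₂
    let h : AdjoinRoot p →ₗ[k] N := h₂ - h₁.comp (LinearMap.mulLeft k (AdjoinRoot.root p))
    have hdef (z) : h z = h₂ z - h₁ (AdjoinRoot.root p * z) := rfl
    have hh (z) : θ (idem₁ k) • h z = h z := by rw [hdef, smul_sub, hh₁, hh₂]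
    -- The right-hand side is moved by `s` to the second vertex. The loop commutes with `idem₂`, so
    -- uniqueness forces `g` to take values there too.
    obtain ⟨g, hg, huniq⟩ := H (mS.comp h)
    simp only [LinearMap.comp_apply, hmS] at hg huniq
    have hg₂ (z) : θ (idem₂ k) • g z = g z := by
      refine LinearMap.congr_fun (huniq ((mE (idem₂ k)).comp g) fun z => ?_) z
      simp only [LinearMap.comp_apply, hmE]
      rw [smul_smul (loop θ s), hs.loop_mul_idem₂, ← hs.idem₂_mul_loop, mul_smul, ← smul_sub, hg,
        smul_smul, hs.idem_mul]
    have hg₁ (z) : θ (arrow₁ k) • g (AdjoinRoot.root p * z) - θ (arrow₂ k) • g z = h z := by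
      have := congrArg (θ (arrow₁ k) • ·) (hg z)
      simp only [smul_sub] at this
      rwa [smul_smul, smul_smul, hs.arrow₁_mul_loop, hs.arrow_mul, hh] at this
    refine ⟨(h₁ + (mE (arrow₁ k)).comp g, g), ⟨fun z => ?_, hg₂, fun z => ?_, fun z => ?_⟩, ?_⟩
    · simp only [LinearMap.add_apply, LinearMap.comp_apply, hmE, smul_add, hh₁]
      rw [smul_smul, ← map_mul, idem₁_mul_arrow₁]
    · simp [hmE]
    · simp only [LinearMap.add_apply, LinearMap.comp_apply, hmE, LinearMap.mulLeft_apply]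
      rw [add_sub_assoc, hg₁, hdef]
      abel
    · rintro ⟨l₁, l₂⟩ ⟨hl₁, hl₂, hl₃, hl₄⟩
      simp only [LinearMap.id_apply, LinearMap.mulLeft_apply] at hl₁ hl₂ hl₃ hl₄
      have e₁ (z) : l₁ z = h₁ z + θ (arrow₁ k) • l₂ z := by rw [← hl₃]; abel
      have e₂ : l₂ = g := huniq l₂ fun z => by
        have : θ (arrow₁ k) • l₂ (AdjoinRoot.root p * z) - θ (arrow₂ k) • l₂ z = h z := by
          rw [hdef, ← hl₄, e₁]; abel
        rw [← this, smul_sub, smul_smul s, hs.mul_arrow, hl₂, hloop _ (hl₂ z)]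
      subst e₂
      exact Prod.ext (LinearMap.ext e₁) rfl

theorem isHomInverted_standardMap_id_mulLeft_iff {s : T} (hs : IsArrowInverse θ s) {p : k[X]}
    (hp : p.Monic) (hirr : Irreducible p) :
    IsHomInverted θ (standardMap LinearMap.id (LinearMap.mulLeft k (AdjoinRoot.root p))) ↔
      IsUnit (hs.evalLoop p) := by
  have key (N : Type u) [AddCommGroup N] [Module T N] :
      (Function.Bijective fun g : ColumnModule k (AdjoinRoot p) (AdjoinRoot p) →ₛₗ[θ] N =>
        g.comp (standardMap LinearMap.id (LinearMap.mulLeft k (AdjoinRoot.root p)))) ↔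
      Function.Bijective fun n : N => hs.evalLoop p • n := by
    let _ : Module k N := Module.compHom N (θ.comp (scalar k))
    have hk (c : k) (n : N) : c • n = θ (scalar k c) • n := rfl
    let _ : Module k[X] N := Module.compHom N hs.evalLoop
    have hX (f : k[X]) (n : N) : f • n = hs.evalLoop f • n := rfl
    have : IsScalarTower k k[X] N := IsScalarTower.of_algebraMap_smul fun c n => by
      rw [algebraMap_eq, hX, hs.evalLoop_C, hk]
    rw [bijective_comp_standardMap_id_mulLeft_iff hs p hk]
    refine Iff.trans ?_ (AdjoinRoot.existsUnique_sub_iff_bijective_smul hp hirr)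
    simp only [hX, hs.evalLoop_X]
  constructor
  · intro H
    -- On `N = T`, surjectivity gives a right inverse of `p(loop)`, and injectivity makes it a left
    -- inverse.
    have hb := (key T).1 (H T)
    obtain ⟨t, ht⟩ := hb.2 1
    simp only [smul_eq_mul] at ht
    refine ⟨⟨hs.evalLoop p, t, ht, hb.1 ?_⟩, rfl⟩
    simp only [smul_eq_mul]
    rw [← mul_assoc, ht, one_mul, mul_one]
  · rintro ⟨t, ht⟩ N _ _
    refine (key N).2 ?_
    rw [← ht]
    exact MulAction.bijective t

end Inverting

end KroneckerAlgebra

/-! ### The ring `D` as a localization of `k[X]` -/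

namespace KroneckerAlgebra

variable {k : Type u} [Field k] {Δ : Set k[X]}

theorem algebraMap_mem_invertedSubring (f : k[X]) :
    algebraMap k[X] (RatFunc k) f ∈ invertedSubring k Δ :=
  Subring.subset_closure (Or.inl ⟨f, rfl⟩)

noncomputable instance : Algebra k[X] (invertedSubring k Δ) :=
  ((algebraMap k[X] (RatFunc k)).codRestrict _ algebraMap_mem_invertedSubring).toAlgebra

theorem closure_le_nonZeroDivisors (hΔ : ∀ p ∈ Δ, p ≠ 0) :
    Submonoid.closure Δ ≤ nonZeroDivisors k[X] :=
  Submonoid.closure_le.2 fun p hp => mem_nonZeroDivisors_of_ne_zero (hΔ p hp)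

/-- The fractions with denominator in the monoid generated by `Δ` form a subring of `k(x)`
containing the generators of `D`, so every element of `D` is such a fraction. -/
theorem isLocalization_invertedSubring (hΔ : ∀ p ∈ Δ, p ≠ 0) :
    IsLocalization (Submonoid.closure Δ) (invertedSubring k Δ) := by
  have hM := closure_le_nonZeroDivisors hΔ
  have hle : invertedSubring k Δ ≤
      (Localization.subalgebra.ofField (RatFunc k) (Submonoid.closure Δ) hM).toSubring := by
    refine Subring.closure_le.2 (Set.union_subset ?_ ?_)
    · rintro _ ⟨f, rfl⟩
      exact ⟨f, 1, one_mem _, by simp⟩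
    · rintro _ ⟨p, hp, rfl⟩
      exact ⟨1, p, Submonoid.subset_closure hp, by simp⟩
  refine ⟨?_, ?_, ?_⟩
  · rintro ⟨f, hf⟩
    have : Submonoid.closure Δ ≤
        (IsUnit.submonoid (invertedSubring k Δ)).comap (algebraMap k[X] (invertedSubring k Δ)) := by
      refine Submonoid.closure_le.2 fun p hp => ?_
      refine IsUnit.of_mul_eq_one
        ⟨1 / algebraMap k[X] (RatFunc k) p, Subring.subset_closure (Or.inr ⟨p, hp, rfl⟩)⟩ ?_
      refine Subtype.ext ?_
      exact mul_one_div_cancel (RatFunc.algebraMap_ne_zero (hΔ p hp))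
    exact this hf
  · rintro ⟨z, hz⟩
    obtain ⟨a, s, hs, rfl⟩ := hle hz
    refine ⟨⟨a, s, hs⟩, Subtype.ext ?_⟩
    exact inv_mul_cancel_right₀
      (RatFunc.algebraMap_ne_zero (nonZeroDivisors.ne_zero (hM hs))) _
  · intro x y h
    exact ⟨1, by rw [RatFunc.algebraMap_injective k (congrArg Subtype.val h)]⟩

theorem isDedekindDomain_invertedSubring (hΔ : ∀ p ∈ Δ, p ≠ 0) :
    IsDedekindDomain (invertedSubring k Δ) :=
  have := isLocalization_invertedSubring hΔ
  IsLocalization.isDedekindDomain k[X] (closure_le_nonZeroDivisors hΔ) _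

end KroneckerAlgebra

/-! ### Maps from a commutative localization to a noncommutative ring -/

section NoncommutativeLift

variable {A B T : Type*} [CommRing A] [CommRing B] [Algebra A B] [Ring T]

/-- The universal property of a commutative localization for maps to noncommutative rings. -/
theorem IsLocalization.exists_ringHom_comp_eq (M : Submonoid A) [IsLocalization M B] (f : A →+* T)
    (hf : ∀ m ∈ M, IsUnit (f m)) : ∃ ρ : B →+* T, ∀ a, ρ (algebraMap A B a) = f a := by
  let fM : M →* Tˣ := IsUnit.liftRight ((f : A →* T).comp M.subtype) fun m => hf m m.2
  let l : Localization M →+* T := OreLocalization.universalHom f fM fun m => rfl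
  refine ⟨l.comp (IsLocalization.algEquiv M B (Localization M)).toRingEquiv.toRingHom,
    fun a => ?_⟩
  have : IsLocalization.algEquiv M B (Localization M) (algebraMap A B a) =
      algebraMap A (Localization M) a := AlgEquiv.commutes _ a
  refine (congrArg l this).trans ?_
  exact OreLocalization.universalHom_commutes f fM fun m => rfl

theorem IsLocalization.commute_map (M : Submonoid A) [IsLocalization M B] (ρ : B →+* T) {t : T}
    (ht : ∀ a, Commute (ρ (algebraMap A B a)) t) (b : B) : Commute (ρ b) t := by
  obtain ⟨⟨a, m⟩, h⟩ := IsLocalization.surj M b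
  obtain ⟨v, hv⟩ := (IsLocalization.map_units B m).map ρ
  have hb : ρ b = ρ (algebraMap A B a) * ↑v⁻¹ := by
    rw [Units.eq_mul_inv_iff_mul_eq, hv, ← map_mul, h]
  have hm := ht m
  rw [← hv] at hm
  rw [hb]
  exact (ht a).mul_left hm.units_inv_left

theorem IsLocalization.ringHom_ext_of_ring (M : Submonoid A) [IsLocalization M B] {ρ σ : B →+* T}
    (h : ∀ a, ρ (algebraMap A B a) = σ (algebraMap A B a)) : ρ = σ := by
  ext b
  obtain ⟨⟨a, m⟩, hb⟩ := IsLocalization.surj M b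
  refine ((IsLocalization.map_units B m).map ρ).mul_right_cancel ?_
  rw [← map_mul, hb, h, h, ← map_mul, hb]

end NoncommutativeLift

/-! ### The universal localization -/

theorem IsUniversalLocalization.nonempty_ringEquiv {R S S' : Type u} [Ring R] [Ring S] [Ring S']
    {Sig : Set (FGProjMap R)} {φ : R →+* S} {φ' : R →+* S'}
    (h : IsUniversalLocalization Sig φ) (h' : IsUniversalLocalization Sig φ') :
    Nonempty (S ≃+* S') := by
  obtain ⟨f, hf, -⟩ := h.universal S' φ' h'.inverting
  obtain ⟨g, hg, -⟩ := h'.universal S φ h.inverting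
  refine ⟨RingEquiv.ofRingHom f g ?_ ?_⟩
  · refine (h'.universal S' φ' h'.inverting).unique ?_ (RingHom.id_comp φ')
    rw [RingHom.comp_assoc, hg, hf]
  · refine (h.universal S φ h.inverting).unique ?_ (RingHom.id_comp φ)
    rw [RingHom.comp_assoc, hf, hg]

namespace KroneckerAlgebra

variable {k : Type u} [Field k] {Δ : Set k[X]}

theorem nonempty_presentation (hΔ : ∀ p ∈ Δ, p.Monic) (U : localizingSet k Δ) :
    Nonempty (FGProjPresentation (KroneckerAlgebra k) U.1) := by
  obtain ⟨U, rfl | ⟨p, hp, rfl⟩⟩ := U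
  · exact ⟨standardPresentation (0 : k →ₗ[k] k) LinearMap.id⟩
  · have := (hΔ p hp).finite_adjoinRoot
    exact ⟨standardPresentation LinearMap.id (LinearMap.mulLeft k (AdjoinRoot.root p))⟩

/-- The right-hand side does not mention the presentations: each `f U` may be exchanged for the
standard one. One homomorphism therefore serves as universal localization for every choice. -/
theorem isInverting_iff {T : Type u} [Ring T] {θ : KroneckerAlgebra k →+* T}
    (hΔ : ∀ p ∈ Δ, p.Monic ∧ Irreducible p)
    (f : ∀ U : localizingSet k Δ, FGProjPresentation (KroneckerAlgebra k) U.1) :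
    IsInverting (Set.range fun U => (f U).toFGProjMap) θ ↔
      ∃ (s : T) (hs : IsArrowInverse θ s), ∀ p ∈ Δ, IsUnit (hs.evalLoop p) := by
  have hV : Function.Bijective (extendedMap θ (f ⟨simpleV k, Or.inl rfl⟩).map) ↔
      ∃ s, IsArrowInverse θ s :=
    (FGProjPresentation.bijective_extendedMap_iff _
      (standardPresentation (0 : k →ₗ[k] k) LinearMap.id)).trans
      isHomInverted_standardMap_zero_id_iff
  have hVp (p : k[X]) (hp : p ∈ Δ) {s : T} (hs : IsArrowInverse θ s) :
      Function.Bijective (extendedMap θ (f ⟨simpleVp k p, Or.inr ⟨p, hp, rfl⟩⟩).map) ↔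
        IsUnit (hs.evalLoop p) := by
    have := (hΔ p hp).1.finite_adjoinRoot
    exact (FGProjPresentation.bijective_extendedMap_iff _
      (standardPresentation LinearMap.id (LinearMap.mulLeft k (AdjoinRoot.root p)))).trans
      (isHomInverted_standardMap_id_mulLeft_iff hs (hΔ p hp).1 (hΔ p hp).2)
  constructor
  · intro H
    obtain ⟨s, hs⟩ := hV.1 (H _ ⟨_, rfl⟩)
    exact ⟨s, hs, fun p hp => (hVp p hp hs).1 (H _ ⟨_, rfl⟩)⟩
  · rintro ⟨s, hs, h⟩ _ ⟨⟨U, rfl | ⟨p, hp, rfl⟩⟩, rfl⟩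
    · exact hV.2 ⟨s, hs⟩
    · exact (hVp p hp hs).2 (h p hp)

/-! ### The universal property of `M₂(D)` -/

variable (k Δ) in
/-- The homomorphism `R → M₂(D)` that maps the arrows to `E₁₂` and `x E₁₂`. -/
noncomputable def toMatrix :
    KroneckerAlgebra k →+* Matrix (Fin 2) (Fin 2) (invertedSubring k Δ) where
  toFun r :=
    !![algebraMap k[X] _ (C r.a), algebraMap k[X] _ (C r.v.1 + C r.v.2 * X);
      0, algebraMap k[X] _ (C r.b)]
  map_one' := by ext i j; fin_cases i <;> fin_cases j <;> simp
  map_zero' := by ext i j; fin_cases i <;> fin_cases j <;> simp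
  map_mul' r s := by
    simp only [mul_a, mul_v, mul_b, Matrix.mul_fin_two]
    congr 1
    simp only [Prod.fst_add, Prod.smul_fst, Prod.snd_add, Prod.smul_snd, smul_eq_mul, map_add,
      map_mul, mul_zero, zero_mul, add_zero, zero_add]
    congr! 3
    ring
  map_add' r s := by
    ext i j
    fin_cases i <;> fin_cases j <;> simp
    ring

theorem toMatrix_apply (r : KroneckerAlgebra k) :
    toMatrix k Δ r = !![algebraMap k[X] _ (C r.a), algebraMap k[X] _ (C r.v.1 + C r.v.2 * X);
      0, algebraMap k[X] _ (C r.b)] := rfl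

theorem toMatrix_idem₁ : toMatrix k Δ (idem₁ k) = !![1, 0; 0, 0] := by simp [toMatrix_apply]

theorem toMatrix_idem₂ : toMatrix k Δ (idem₂ k) = !![0, 0; 0, 1] := by simp [toMatrix_apply]

theorem toMatrix_arrow₁ : toMatrix k Δ (arrow₁ k) = !![0, 1; 0, 0] := by simp [toMatrix_apply]

theorem toMatrix_arrow₂ :
    toMatrix k Δ (arrow₂ k) = !![0, algebraMap k[X] _ X; 0, 0] := by simp [toMatrix_apply]

theorem isArrowInverse_toMatrix : IsArrowInverse (toMatrix k Δ) !![0, 0; 1, 0] where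
  arrow_mul := by rw [toMatrix_arrow₁, toMatrix_idem₁, Matrix.mul_fin_two]; simp
  mul_arrow := by rw [toMatrix_arrow₁, toMatrix_idem₂, Matrix.mul_fin_two]; simp
  idem_mul := by rw [toMatrix_idem₂, Matrix.mul_fin_two]; simp
  mul_idem := by rw [toMatrix_idem₁, Matrix.mul_fin_two]; simp

/-- The loop is `xE₁₂E₂₁ + E₂₁xE₁₂ = x · 1`. -/
theorem evalLoop_toMatrix (f : k[X]) :
    (isArrowInverse_toMatrix (Δ := Δ)).evalLoop f =
      Matrix.scalar (Fin 2) (algebraMap k[X] (invertedSubring k Δ) f) := by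
  have : (isArrowInverse_toMatrix (Δ := Δ)).evalLoop =
      (Matrix.scalar (Fin 2)).comp (algebraMap k[X] (invertedSubring k Δ)) := by
    refine Polynomial.ringHom_ext (fun c => ?_) ?_
    · rw [IsArrowInverse.evalLoop_C]
      ext i j
      fin_cases i <;> fin_cases j <;> simp [toMatrix_apply]
    · rw [IsArrowInverse.evalLoop_X, loop, toMatrix_arrow₂]
      ext i j
      fin_cases i <;> fin_cases j <;> simp [Algebra.smul_def]
  rw [this]; rfl

namespace IsArrowInverse

variable {T : Type u} [Ring T] {θ : KroneckerAlgebra k →+* T} {s : T}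

theorem map {T' : Type u} [Ring T'] (hs : IsArrowInverse θ s) (ψ : T →+* T') :
    IsArrowInverse (ψ.comp θ) (ψ s) where
  arrow_mul := by simp only [RingHom.comp_apply, ← map_mul, hs.arrow_mul]
  mul_arrow := by simp only [RingHom.comp_apply, ← map_mul, hs.mul_arrow]
  idem_mul := by simp only [RingHom.comp_apply, ← map_mul, hs.idem_mul]
  mul_idem := by simp only [RingHom.comp_apply, ← map_mul, hs.mul_idem]

theorem map_evalLoop {T' : Type u} [Ring T'] (hs : IsArrowInverse θ s) (ψ : T →+* T') (f : k[X]) :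
    ψ (hs.evalLoop f) = (hs.map ψ).evalLoop f := by
  have : ψ.comp hs.evalLoop = (hs.map ψ).evalLoop := by
    refine Polynomial.ringHom_ext (fun c => ?_) ?_
    · simp only [RingHom.comp_apply, evalLoop_C]
    · simp only [RingHom.comp_apply, evalLoop_X, loop, map_add, map_mul]
  exact RingHom.congr_fun this f

variable {D : Type u} [CommRing D]

/-- The homomorphism `M₂(D) → T` given by a homomorphism `D → T` that is compatible with the
matrix units `θ(idem₁)`, `θ(arrow₁)`, `s`, `θ(idem₂)`. -/
def matrixLift (hs : IsArrowInverse θ s) (ρ : D →+* T)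
    (hρ : ∀ t, t = s ∨ t ∈ ({θ (idem₁ k), θ (idem₂ k), θ (arrow₁ k)} : Set T) →
      ∀ d, Commute (ρ d) t) : Matrix (Fin 2) (Fin 2) D →+* T where
  toFun m := ρ (m 0 0) * θ (idem₁ k) + ρ (m 0 1) * θ (arrow₁ k) + ρ (m 1 0) * s
    + ρ (m 1 1) * θ (idem₂ k)
  map_zero' := by simp
  map_one' := by simp [← map_add, idem₁_add_idem₂]
  map_add' m n := by
    simp only [Matrix.add_apply, map_add, add_mul]
    abel
  map_mul' m n := by
    have h₁ (d) := hρ (θ (idem₁ k)) (by simp) d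
    have h₂ (d) := hρ (θ (idem₂ k)) (by simp) d
    have h₃ (d) := hρ (θ (arrow₁ k)) (by simp) d
    have h₄ (d) := hρ s (by simp) d
    -- Moving coefficients to the left reduces multiplicativity to the multiplication table of the
    -- matrix units.
    have hmul (x y : D) (u v : T) (h : ∀ d, Commute (ρ d) u) :
        ρ x * u * (ρ y * v) = ρ (x * y) * (u * v) := by
      rw [map_mul, mul_assoc, ← mul_assoc u, ← (h y).eq]
      simp only [mul_assoc]
    have z₁ : arrow₁ k * idem₁ k = 0 := by ext <;> simp
    have z₂ : arrow₁ k * arrow₁ k = 0 := by ext <;> simp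
    have z₃ : idem₂ k * arrow₁ k = 0 := by ext <;> simp
    simp only [mul_add, add_mul, hmul _ _ _ _ h₁, hmul _ _ _ _ h₂, hmul _ _ _ _ h₃,
      hmul _ _ _ _ h₄, hs.arrow_mul, hs.mul_arrow, hs.idem_mul, hs.mul_idem, hs.mul_idem₂,
      hs.idem₁_mul, hs.mul_self, ← map_mul θ, idem₁_mul_idem₁, idem₁_mul_idem₂, idem₂_mul_idem₁,
      idem₂_mul_idem₂, idem₁_mul_arrow₁, arrow₁_mul_idem₂, z₁, z₂, z₃, map_zero, mul_zero,
      add_zero, zero_add, Matrix.mul_apply, Fin.sum_univ_two, map_add]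
    abel

end IsArrowInverse

/-- Evaluation at the loop extends to `D` because it makes `Δ` invertible, and its image still
commutes with the matrix units. For uniqueness, `E₂₁` must go to the only inverse of `arrow₁`; this
fixes the loop, hence the values on `k[X]` and on `D`. -/
theorem existsUnique_comp_toMatrix_eq (hΔ : ∀ p ∈ Δ, p ≠ 0) {T : Type u} [Ring T]
    {θ : KroneckerAlgebra k →+* T} {s : T} (hs : IsArrowInverse θ s)
    (hu : ∀ p ∈ Δ, IsUnit (hs.evalLoop p)) :
    ∃! ψ : Matrix (Fin 2) (Fin 2) (invertedSubring k Δ) →+* T, ψ.comp (toMatrix k Δ) = θ := by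
  have := isLocalization_invertedSubring hΔ
  have hunit : ∀ m ∈ Submonoid.closure Δ, IsUnit (hs.evalLoop m) := by
    have : Submonoid.closure Δ ≤ (IsUnit.submonoid T).comap hs.evalLoop :=
      Submonoid.closure_le.2 hu
    exact fun m hm => this hm
  obtain ⟨ρ, hρ⟩ := IsLocalization.exists_ringHom_comp_eq (B := invertedSubring k Δ)
    (Submonoid.closure Δ) hs.evalLoop hunit
  have hcomm : ∀ t, t = s ∨ t ∈ ({θ (idem₁ k), θ (idem₂ k), θ (arrow₁ k)} : Set T) →
      ∀ d, Commute (ρ d) t := by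
    intro t ht
    refine IsLocalization.commute_map (Submonoid.closure Δ) ρ fun f => ?_
    rw [hρ]
    rcases ht with rfl | rfl | rfl | rfl
    · exact hs.commute_evalLoop hs.commute_scalar_inverse hs.commute_inverse_loop.symm f
    · exact hs.commute_evalLoop (fun c => commute_map_scalar θ c _)
        (hs.loop_mul_idem₁.trans hs.idem₁_mul_loop.symm) f
    · exact hs.commute_evalLoop (fun c => commute_map_scalar θ c _)
        (hs.loop_mul_idem₂.trans hs.idem₂_mul_loop.symm) f
    · exact hs.commute_evalLoop (fun c => commute_map_scalar θ c _)
        (hs.loop_mul_arrow₁.trans hs.arrow₁_mul_loop.symm) f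
  refine ⟨hs.matrixLift ρ hcomm, RingHom.ext fun r => ?_, fun ψ hψ => RingHom.ext fun m => ?_⟩
  · conv_rhs => rw [eq_sum r]
    simp only [RingHom.comp_apply, IsArrowInverse.matrixLift, RingHom.coe_mk, MonoidHom.coe_mk,
      OneHom.coe_mk, toMatrix_apply, Matrix.of_apply, Matrix.cons_val', Matrix.cons_val_zero,
      Matrix.cons_val_one, Matrix.cons_val_fin_one, hρ, map_zero, zero_mul, add_zero, map_add,
      map_mul, hs.evalLoop_C, hs.evalLoop_X, add_mul]
    rw [mul_assoc _ (loop θ s), hs.loop_mul_arrow₁]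
    abel
  · subst hψ
    have hs' : s = ψ !![0, 0; 1, 0] := hs.eq_of_isArrowInverse (isArrowInverse_toMatrix.map ψ)
    subst hs'
    have hψρ : ψ.comp (Matrix.scalar (Fin 2)) = ρ :=
      IsLocalization.ringHom_ext_of_ring (Submonoid.closure Δ) fun f => by
        rw [hρ, RingHom.comp_apply, ← evalLoop_toMatrix, IsArrowInverse.map_evalLoop]
    have hm : m = Matrix.scalar (Fin 2) (m 0 0) * toMatrix k Δ (idem₁ k)
        + Matrix.scalar (Fin 2) (m 0 1) * toMatrix k Δ (arrow₁ k)
        + Matrix.scalar (Fin 2) (m 1 0) * !![0, 0; 1, 0]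
        + Matrix.scalar (Fin 2) (m 1 1) * toMatrix k Δ (idem₂ k) := by
      rw [toMatrix_idem₁, toMatrix_idem₂, toMatrix_arrow₁]
      ext i j
      fin_cases i <;> fin_cases j <;> simp
    conv_lhs => rw [hm]
    simp only [map_add, map_mul]
    simp only [← RingHom.comp_apply, hψρ]
    rfl

theorem isUniversalLocalization_toMatrix (hΔ : ∀ p ∈ Δ, p.Monic ∧ Irreducible p)
    (f : ∀ U : localizingSet k Δ, FGProjPresentation (KroneckerAlgebra k) U.1) :
    IsUniversalLocalization (Set.range fun U => (f U).toFGProjMap) (toMatrix k Δ) where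
  inverting := by
    have := isLocalization_invertedSubring fun p hp => (hΔ p hp).2.ne_zero
    refine (isInverting_iff hΔ f).2 ⟨_, isArrowInverse_toMatrix, fun p hp => ?_⟩
    rw [evalLoop_toMatrix]
    exact (IsLocalization.map_units (invertedSubring k Δ)
      (⟨p, Submonoid.subset_closure hp⟩ : Submonoid.closure Δ)).map _
  universal T _ θ hθ := by
    obtain ⟨s, hs, hu⟩ := (isInverting_iff hΔ f).1 hθ
    exact existsUnique_comp_toMatrix_eq (fun p hp => (hΔ p hp).2.ne_zero) hs hu

end KroneckerAlgebra

theorem lemma4p6 (k : Type u) [Field k] (Δ : Set k[X])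
    (hΔ : ∀ p ∈ Δ, p.Monic ∧ Irreducible p) :
    (∃ φ : KroneckerAlgebra k →+* Matrix (Fin 2) (Fin 2) (KroneckerAlgebra.invertedSubring k Δ),
      IsUniversalLocalizationAt (KroneckerAlgebra.localizingSet k Δ) φ) ∧
    (∀ (S : Type u) [Ring S] (φ : KroneckerAlgebra k →+* S),
      IsUniversalLocalizationAt (KroneckerAlgebra.localizingSet k Δ) φ →
        Nonempty (S ≃+* Matrix (Fin 2) (Fin 2) (KroneckerAlgebra.invertedSubring k Δ)) ∧
        IsMoritaEquivalent ℤ S (KroneckerAlgebra.invertedSubring k Δ)) ∧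
    IsDedekindDomain (KroneckerAlgebra.invertedSubring k Δ) := by
  refine ⟨⟨KroneckerAlgebra.toMatrix k Δ, fun U =>
      (KroneckerAlgebra.nonempty_presentation (fun p hp => (hΔ p hp).1) U).some,
      KroneckerAlgebra.isUniversalLocalization_toMatrix hΔ _⟩, ?_,
    KroneckerAlgebra.isDedekindDomain_invertedSubring fun p hp => (hΔ p hp).2.ne_zero⟩
  rintro S _ φ ⟨f, hf⟩
  -- `toMatrix` is universal for the same presentations `f` that define `S`, so the two
  -- localizations can be compared directly.
  obtain ⟨e⟩ := hf.nonempty_ringEquiv (KroneckerAlgebra.isUniversalLocalization_toMatrix hΔ f)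
  refine ⟨⟨e⟩, (IsMoritaEquivalent.of_algEquiv ℤ (AlgEquiv.ofRingEquiv (f := e) (by simp))).trans ℤ
    (IsMoritaEquivalent.matrix _ (ι := Fin 2) ℤ).symm⟩
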